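/- Fix an integer $s\ge 2$. There is an integer $n_0=n_0(s)$ such that the following holds for every integer $n\ge n_0$. (i) Let $P$ be a set of $n$ points and $L$ a set of $m$ lines in the Euclidean plane $\mathbb{R}^2$ such that (a) no line of $L$ contains more than $\frac{n-1}{s-1}$ points of $P$, and (b) every $s$-element subset of $P$ contains two distinct points that lie on a common line of $L$. Then $m\ge \frac{n-1}{s-1}+s-1$. (ii) If $(s-1)\mid(n-1)$, this bound is tight: there are a set $P$ of $n$ points and a set $L$ of $m$ lines in $\mathbb{R}^2$ satisfying (a) and (b) with $m=\frac{n-1}{s-1}+s-1$. Moreover, $P$ and $L$ can be chosen as a planar realization of the following grid. With $t=\frac{n-1}{s-1}$, the grid has the point set $([t]\times[s-1])\cup\{z\}$, and its lines are the $s-1$ columns $[t]\times\{i\}$ $(1\le i\le s-1)$ and the $t$ extended rows $(\{j\}\times[s-1])\cup\{z\}$ $(1\le j\le t)$. A planar realization means that there are bijections from the points of the grid to $P$ and from the lines of the grid to $L$ such that a point of the grid is on a line of the grid if and only if the corresponding point of $P$ is on the corresponding line of $L$. -/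

import Mathlib

/-- The Euclidean plane. -/
abbrev Plane : Type := EuclideanSpace ℝ (Fin 2)

/-- A line in the plane: an affine subspace whose direction is one-dimensional
(such a subspace is automatically nonempty). -/
def IsPlaneLine (l : AffineSubspace ℝ Plane) : Prop :=
  Module.finrank ℝ l.direction = 1

/-- The hypotheses on a finite set `P` of points and a finite set `L` of lines in the plane:
no line of `L` contains more than `(|P| - 1) / (s - 1)` points of `P`, and every `s`-subset
of `P` contains two distinct points lying on a common line of `L`. -/
structure IsPlaneCover (s : ℕ) (P : Finset Plane) (L : Finset (AffineSubspace ℝ Plane)) :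
    Prop where
  isLine : ∀ l ∈ L, IsPlaneLine l
  card_le : ∀ l ∈ L,
    (Set.ncard {p : Plane | p ∈ P ∧ p ∈ l} : ℝ) ≤ ((P.card : ℝ) - 1) / ((s : ℝ) - 1)
  covers : ∀ S : Finset Plane, S ⊆ P → S.card = s →
    ∃ l ∈ L, ∃ p ∈ S, ∃ q ∈ S, p ≠ q ∧ p ∈ l ∧ q ∈ l

/-- The lines of the `t × k` grid with one extra point `z = none`:
the `k` columns `[t] × {i}`, and the `t` rows `{j} × [k]`, each with `z` appended. -/
def gridLine (t k : ℕ) : Fin k ⊕ Fin t → Set (Option (Fin t × Fin k))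
  | Sum.inl i => {x | ∃ j : Fin t, x = some (j, i)}
  | Sum.inr j => {x | x = none ∨ ∃ i : Fin k, x = some (j, i)}

/-- `(P, L)` is a planar realization of the `t × k` grid with one extra point: points and lines
correspond bijectively to those of the grid, and incidences are exactly those of the grid. -/
def IsGridRealization (t k : ℕ) (P : Finset Plane) (L : Finset (AffineSubspace ℝ Plane)) :
    Prop :=
  ∃ (e : Option (Fin t × Fin k) ≃ P) (f : Fin k ⊕ Fin t ≃ L),
    ∀ (x : Option (Fin t × Fin k)) (c : Fin k ⊕ Fin t),
      (e x : Plane) ∈ (f c : AffineSubspace ℝ Plane) ↔ x ∈ gridLine t k c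

/-! Put k = s - 1 and t = (n - 1)/k. Only one geometric fact enters the lower bound: two lines share
at most one point. Call a set of points independent if no line joins two of its points. The covering
condition says that independent sets have at most k points, and the aim is |L| ≥ t + k. Suppose |L|
< t + k and let D have order √n.

Call a line long if it has at least 8kD points, and let J be the set of long lines. Points of degree
above D are rare on every line, so points can be chosen greedily, one on each long line, to be
pairwise unjoined (`exists_transversal`). Hence |J| ≤ k. An independent set of low-degree points off
J extends in the same way, so it has at most r = k - |J| points. All but at most D of the points off
J have low degree; let V be the set of these.

If r ≥ 2, V has about rt points or more, while about t lines, all short on V, remain. The mean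
degree in V is then at most about |V|/r, so a greedy Turán argument nearly gives r + 1 independent
points. If it fails, stability splits most of V into r cliques of nearly equal size, and a clique
covered by short lines needs more incidences than the lines can supply
(`IsLinear.exists_indep_of_few_lines`).

If r = 1, V is a clique. When all points off J form a clique, de Bruijn–Erdős gives at least t + 1
further lines. Otherwise two unjoined points off J have degree sum about t or more, and the lines
through one of them come on top of those needed for the clique
(`IsLinear.le_card_of_long_add_one_eq`).

If r = 0, at least one and at most D points lie off J. Two such points have degree near t each,
which gives nearly 2t lines. A single one forces the long lines to be disjoint and full, and then t
further lines are needed (`IsLinear.le_card_of_long_eq`).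

For tightness, z is the origin, the rows are lines through it, and the columns are vertical lines.
-/

namespace LinearSystem

/-! ### Linear systems: double counting and second moments. -/

section Basic

open scoped Classical

variable {α ι : Type*}

/-- Any two distinct members of the family `B` indexed by `L` share at most one point. -/
def IsLinear (L : Finset ι) (B : ι → Finset α) : Prop :=
  ∀ l ∈ L, ∀ l' ∈ L, ∀ p q : α, p ∈ B l → q ∈ B l → p ∈ B l' → q ∈ B l' → p = q ∨ l = l'

/-- Two points lie on a common line. -/
def Joined (L : Finset ι) (B : ι → Finset α) (p q : α) : Prop :=
  ∃ l ∈ L, p ∈ B l ∧ q ∈ B l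

/-- No two distinct points of `I` lie on a common line. -/
def IsIndep (L : Finset ι) (B : ι → Finset α) (I : Finset α) : Prop :=
  ∀ p ∈ I, ∀ q ∈ I, p ≠ q → ¬ Joined L B p q

/-- The number of lines through a point. -/
noncomputable def lineDeg (L : Finset ι) (B : ι → Finset α) (p : α) : ℕ :=
  (L.filter (fun l => p ∈ B l)).card

variable {L : Finset ι} {B : ι → Finset α}

theorem Joined.symm {p q : α} (h : Joined L B p q) : Joined L B q p := by
  obtain ⟨l, hl, hp, hq⟩ := h
  exact ⟨l, hl, hq, hp⟩

theorem IsIndep.mono {I I' : Finset α} (h : IsIndep L B I) (hs : I' ⊆ I) : IsIndep L B I' :=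
  fun p hp q hq => h p (hs hp) q (hs hq)

theorem IsIndep.insert_point {I : Finset α} {y : α} (h : IsIndep L B I)
    (hy : ∀ x ∈ I, ¬ Joined L B x y) : IsIndep L B (insert y I) := by
  intro p hp q hq hpq
  rw [Finset.mem_insert] at hp hq
  rcases hp with rfl | hp <;> rcases hq with rfl | hq
  · exact absurd rfl hpq
  · exact fun hj => hy q hq hj.symm
  · exact hy p hp
  · exact h p hp q hq hpq

theorem IsLinear.mono {L' : Finset ι} (h : IsLinear L B) (hs : L' ⊆ L) : IsLinear L' B :=
  fun l hl l' hl' => h l (hs hl) l' (hs hl')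

theorem IsLinear.inter (h : IsLinear L B) (V : Finset α) : IsLinear L (fun l => B l ∩ V) :=
  fun l hl l' hl' p q h1 h2 h3 h4 => h l hl l' hl' p q (Finset.mem_inter.1 h1).1
    (Finset.mem_inter.1 h2).1 (Finset.mem_inter.1 h3).1 (Finset.mem_inter.1 h4).1

theorem IsLinear.card_inter_le_one (h : IsLinear L B) {l l' : ι} (hl : l ∈ L) (hl' : l' ∈ L)
    (hne : l ≠ l') : (B l ∩ B l').card ≤ 1 := by
  rw [Finset.card_le_one]
  intro p hp q hq
  rw [Finset.mem_inter] at hp hq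
  exact (h l hl l' hl' p q hp.1 hq.1 hp.2 hq.2).resolve_right hne

theorem sum_lineDeg (V : Finset α) :
    ∑ p ∈ V, lineDeg L B p = ∑ l ∈ L, (B l ∩ V).card := by
  have h := Finset.sum_card_bipartiteAbove_eq_sum_card_bipartiteBelow
    (s := V) (t := L) (fun p l => p ∈ B l)
  simp only [Finset.bipartiteAbove, Finset.bipartiteBelow] at h
  unfold lineDeg
  rw [h]
  refine Finset.sum_congr rfl fun l _ => ?_
  congr 1
  ext x
  simp [and_comm]

/-- A point off a line is joined to at most as many points of it as there are lines through it. -/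
theorem IsLinear.card_joined_le (h : IsLinear L B) {j : ι} (hj : j ∈ L) {q : α} (hq : q ∉ B j) :
    ((B j).filter (fun y => Joined L B q y)).card ≤ lineDeg L B q := by
  have hsub : (B j).filter (fun y => Joined L B q y) ⊆
      (L.filter (fun l => q ∈ B l)).biUnion (fun l => B l ∩ B j) := by
    intro y hy
    rw [Finset.mem_filter] at hy
    obtain ⟨hyj, l, hl, hql, hyl⟩ := hy
    simp only [Finset.mem_biUnion, Finset.mem_filter, Finset.mem_inter]
    exact ⟨l, ⟨hl, hql⟩, hyl, hyj⟩
  refine (Finset.card_le_card hsub).trans ?_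
  refine (Finset.card_biUnion_le_card_mul _ _ 1 ?_).trans (by simp [lineDeg])
  intro l hl
  rw [Finset.mem_filter] at hl
  refine h.card_inter_le_one hl.1 hj ?_
  rintro rfl
  exact hq hl.2

/-- Few points of a line lie on many other lines. -/
theorem IsLinear.card_lineDeg_gt (h : IsLinear L B) {j : ι} (hj : j ∈ L) (D : ℕ) :
    ((B j).filter (fun y => D < lineDeg L B y)).card * D ≤ L.card := by
  set Z := (B j).filter (fun y => D < lineDeg L B y) with hZ
  -- Besides `j`, at least D lines pass through each such point, and each of these lines meets `j`
  -- only once, so none is counted twice.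
  have h1 : ∀ y ∈ Z, D ≤ lineDeg (L.erase j) B y := by
    intro y hy
    rw [hZ, Finset.mem_filter] at hy
    have : (L.erase j).filter (fun l => y ∈ B l) = (L.filter (fun l => y ∈ B l)).erase j :=
      Finset.filter_erase ..
    have h2 := Finset.pred_card_le_card_erase (s := L.filter (fun l => y ∈ B l)) (a := j)
    have h3 := hy.2
    unfold lineDeg at h3 ⊢
    rw [this]
    omega
  have h2 : Z.card * D ≤ ∑ y ∈ Z, lineDeg (L.erase j) B y := by
    simpa using Finset.card_nsmul_le_sum Z _ D h1
  rw [sum_lineDeg] at h2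
  refine h2.trans ?_
  have h3 : ∑ l ∈ L.erase j, (B l ∩ Z).card ≤ ∑ l ∈ L.erase j, 1 := by
    refine Finset.sum_le_sum fun l hl => ?_
    rw [Finset.mem_erase] at hl
    refine (Finset.card_le_card ?_).trans (h.card_inter_le_one hl.2 hj hl.1)
    exact Finset.inter_subset_inter_left (Finset.filter_subset _ _)
  refine h3.trans ?_
  simpa using Finset.card_le_card (Finset.erase_subset j L)

theorem IsLinear.pairwiseDisjoint_offDiag (h : IsLinear L B) :
    (L : Set ι).PairwiseDisjoint (fun l => (B l).offDiag) := by
  intro l hl l' hl' hne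
  rw [Function.onFun, Finset.disjoint_left]
  rintro ⟨p, q⟩ hp hq
  rw [Finset.mem_offDiag] at hp hq
  rcases h l hl l' hl' p q hp.1 hp.2.1 hq.1 hq.2.1 with h1 | h1
  · exact hp.2.2 h1
  · exact hne h1

theorem IsLinear.sum_offDiag_le (h : IsLinear L B) (V : Finset α) :
    ∑ l ∈ L, (B l ∩ V).offDiag.card ≤ V.offDiag.card := by
  rw [← Finset.card_biUnion (h.inter V).pairwiseDisjoint_offDiag]
  refine Finset.card_le_card (Finset.biUnion_subset.2 fun l _ => ?_)
  exact Finset.offDiag_mono Finset.inter_subset_right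

/-- The number of ordered pairs of distinct joined points is at most the number of
ordered pairs of distinct points on the lines. -/
theorem sum_joined_le (V : Finset α) :
    ∑ v ∈ V, (V.filter (fun x => v ≠ x ∧ Joined L B v x)).card ≤
      ∑ l ∈ L, (B l ∩ V).offDiag.card := by
  rw [← Finset.card_sigma]
  refine le_trans ?_ Finset.card_biUnion_le
  refine Finset.card_le_card_of_injOn (fun x => (x.1, x.2)) ?_ ?_
  · rintro ⟨v, x⟩ hx
    simp only [Finset.coe_sigma, Set.mem_sigma_iff, Finset.mem_coe, Finset.mem_filter] at hx
    obtain ⟨hv, hx, hne, l, hl, hvl, hxl⟩ := hx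
    simp only [Finset.coe_biUnion, Set.mem_iUnion, Finset.mem_coe, Finset.mem_offDiag,
      Finset.mem_inter]
    exact ⟨l, hl, ⟨hvl, hv⟩, ⟨hxl, hx⟩, hne⟩
  · rintro ⟨v, x⟩ _ ⟨v', x'⟩ _ hxy
    simpa using hxy

theorem card_offDiag_le_of_clique {V : Finset α}
    (hV : ∀ p ∈ V, ∀ q ∈ V, p ≠ q → Joined L B p q) :
    V.offDiag.card ≤ ∑ l ∈ L, (B l ∩ V).offDiag.card := by
  refine (Finset.card_le_card ?_).trans Finset.card_biUnion_le
  rintro ⟨p, q⟩ hpq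
  rw [Finset.mem_offDiag] at hpq
  obtain ⟨l, hl, h1, h2⟩ := hV p hpq.1 q hpq.2.1 hpq.2.2
  simp only [Finset.mem_biUnion, Finset.mem_offDiag, Finset.mem_inter]
  exact ⟨l, hl, ⟨h1, hpq.1⟩, ⟨h2, hpq.2.1⟩, hpq.2.2⟩

theorem cast_offDiag_card (V : Finset α) :
    (V.offDiag.card : ℝ) = (V.card : ℝ) ^ 2 - V.card := by
  rw [Finset.offDiag_card, Nat.cast_sub (Nat.le_mul_self _)]
  push_cast
  ring

/-- Few points lie on many lines. -/
theorem IsLinear.card_mul_le (h : IsLinear L B) {Z : Finset α} {d : ℕ}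
    (hd : ∀ q ∈ Z, d ≤ lineDeg L B q) : Z.card * d + Z.card ≤ L.card + Z.card * Z.card := by
  have h1 : Z.card * d ≤ ∑ y ∈ Z, lineDeg L B y := by
    simpa using Finset.card_nsmul_le_sum Z _ d hd
  rw [sum_lineDeg] at h1
  -- For natural a, a ≤ 1 + a(a - 1); the ordered pairs on all lines together number at most |Z|(|Z|
  -- - 1).
  have h2 : ∑ l ∈ L, (B l ∩ Z).card ≤ ∑ l ∈ L, (1 + (B l ∩ Z).offDiag.card) := by
    refine Finset.sum_le_sum fun l _ => ?_
    rw [Finset.offDiag_card]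
    generalize (B l ∩ Z).card = a
    rcases a with _ | _ | a
    · simp
    · simp
    · have : (a + 1 + 1) * 2 ≤ (a + 1 + 1) * (a + 1 + 1) := Nat.mul_le_mul_left _ (by omega)
      omega
  have h3 := h.sum_offDiag_le Z
  rw [Finset.sum_add_distrib] at h2
  rw [Finset.offDiag_card] at h3
  simp only [Finset.sum_const, smul_eq_mul, mul_one] at h2
  have := Nat.le_mul_self Z.card
  omega

/-- A second moment inequality for line sizes. -/
theorem IsLinear.sq_sum_sq_le (h : IsLinear L B) (V : Finset α) {T : ℝ}
    (hT : ∀ l ∈ L, ((B l ∩ V).card : ℝ) ≤ T) :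
    (∑ l ∈ L, ((B l ∩ V).card : ℝ) ^ 2) ^ 2 ≤
      V.card * (T * ∑ l ∈ L, ((B l ∩ V).card : ℝ) ^ 2 + (∑ l ∈ L, ((B l ∩ V).card : ℝ)) ^ 2) := by
  set w : ι → ℝ := fun l => ((B l ∩ V).card : ℝ) with hw
  have hw0 : ∀ l, 0 ≤ w l := fun l => Nat.cast_nonneg _
  have hcard : ∀ A : Finset α, A ⊆ V → (A.card : ℝ) = ∑ p ∈ V, if p ∈ A then (1 : ℝ) else 0 := by
    intro A hA
    rw [Finset.sum_ite_mem, Finset.inter_eq_right.2 hA]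
    simp
  -- Give each point the total size of the lines through it. These weights sum to ∑ w², and
  -- Cauchy–Schwarz is applied to them.
  have e1 : ∑ l ∈ L, w l ^ 2 = ∑ p ∈ V, ∑ l ∈ L, if p ∈ B l ∩ V then w l else 0 := by
    rw [Finset.sum_comm]
    refine Finset.sum_congr rfl fun l _ => ?_
    rw [sq]
    nth_rewrite 2 [hw]
    simp only
    rw [hcard _ Finset.inter_subset_right, Finset.mul_sum]
    refine Finset.sum_congr rfl fun p _ => ?_
    split_ifs <;> simp
  have e2 : ∑ p ∈ V, (∑ l ∈ L, if p ∈ B l ∩ V then w l else 0) ^ 2 =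
      ∑ l ∈ L, ∑ l' ∈ L, w l * w l' * (((B l ∩ V) ∩ (B l' ∩ V)).card : ℝ) := by
    simp_rw [sq, Finset.sum_mul_sum]
    rw [Finset.sum_comm]
    refine Finset.sum_congr rfl fun l _ => ?_
    rw [Finset.sum_comm]
    refine Finset.sum_congr rfl fun l' _ => ?_
    rw [hcard _ (Finset.inter_subset_left.trans Finset.inter_subset_right), Finset.mul_sum]
    refine Finset.sum_congr rfl fun p _ => ?_
    by_cases h1 : p ∈ B l ∩ V <;> by_cases h2 : p ∈ B l' ∩ V <;>
      simp only [Finset.mem_inter (s₁ := B l ∩ V), h1, h2] <;> simp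
  -- Diagonal terms are w³ ≤ T w²; distinct lines meet in at most one point.
  have e3 : ∑ l ∈ L, ∑ l' ∈ L, w l * w l' * (((B l ∩ V) ∩ (B l' ∩ V)).card : ℝ) ≤
      ∑ l ∈ L, (T * w l ^ 2 + w l * ∑ l' ∈ L, w l') := by
    refine Finset.sum_le_sum fun l hl => ?_
    have e4 : ∀ l' ∈ L, w l * w l' * (((B l ∩ V) ∩ (B l' ∩ V)).card : ℝ) ≤
        (if l = l' then T * w l ^ 2 else 0) + w l * w l' := by
      intro l' hl'
      have hww := mul_nonneg (hw0 l) (hw0 l')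
      split_ifs with heq
      · subst heq
        rw [Finset.inter_self]
        have : w l * w l * w l ≤ T * w l ^ 2 := by
          have := mul_le_mul_of_nonneg_right (hT l hl) hww
          calc w l * w l * w l = w l * (w l * w l) := by ring
            _ ≤ T * (w l * w l) := this
            _ = T * w l ^ 2 := by ring
        exact this.trans (by linarith)
      · have : ((((B l ∩ V) ∩ (B l' ∩ V)).card : ℕ) : ℝ) ≤ 1 := by
          exact_mod_cast (h.inter V).card_inter_le_one hl hl' heq
        nlinarith
    refine (Finset.sum_le_sum e4).trans ?_
    rw [Finset.sum_add_distrib, Finset.sum_ite_eq, if_pos hl, Finset.mul_sum]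
  have e5 : ∑ l ∈ L, (T * w l ^ 2 + w l * ∑ l' ∈ L, w l') =
      T * ∑ l ∈ L, w l ^ 2 + (∑ l ∈ L, w l) ^ 2 := by
    rw [Finset.sum_add_distrib, ← Finset.mul_sum, ← Finset.sum_mul, sq (∑ l ∈ L, w l)]
  have e6 := sq_sum_le_card_mul_sum_sq (s := V)
    (f := fun p => ∑ l ∈ L, if p ∈ B l ∩ V then w l else 0)
  rw [← e1, e2] at e6
  exact e6.trans (mul_le_mul_of_nonneg_left (e3.trans e5.le) (Nat.cast_nonneg _))

/-- Bound (∑ w)² by |L| ∑ w² in `sq_sum_sq_le` and cancel one factor ∑ w². This makes |L| + T an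
upper bound for the mean degree in the joining graph. -/
theorem IsLinear.sum_sq_le (h : IsLinear L B) (V : Finset α) {T : ℝ} (hT0 : 0 ≤ T)
    (hT : ∀ l ∈ L, ((B l ∩ V).card : ℝ) ≤ T) :
    ∑ l ∈ L, ((B l ∩ V).card : ℝ) ^ 2 ≤ V.card * (L.card + T) := by
  have h1 := h.sq_sum_sq_le V hT
  have h2 := sq_sum_le_card_mul_sum_sq (s := L) (f := fun l => ((B l ∩ V).card : ℝ))
  set X := ∑ l ∈ L, ((B l ∩ V).card : ℝ) ^ 2
  have hX : 0 ≤ X := Finset.sum_nonneg fun _ _ => sq_nonneg _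
  have hV : (0 : ℝ) ≤ V.card := Nat.cast_nonneg _
  have hL : (0 : ℝ) ≤ L.card := Nat.cast_nonneg _
  rcases hX.eq_or_lt with h0 | h0
  · rw [← h0]; positivity
  · refine le_of_mul_le_mul_right ?_ h0
    calc X * X = X ^ 2 := by ring
      _ ≤ _ := h1
      _ ≤ V.card * (T * X + L.card * X) := by gcongr
      _ = _ := by ring

/-- A clique covered by lines has many incidences. -/
theorem IsLinear.le_sq_sum_of_clique (h : IsLinear L B) {V : Finset α} {T w : ℝ} (hT0 : 0 ≤ T)
    (hT : ∀ l ∈ L, ((B l ∩ V).card : ℝ) ≤ T)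
    (hV : ∀ p ∈ V, ∀ q ∈ V, p ≠ q → Joined L B p q) (hw : 0 ≤ w) (hwV : w + T + 1 ≤ V.card) :
    w ^ 3 ≤ (∑ l ∈ L, ((B l ∩ V).card : ℝ)) ^ 2 := by
  have h1 := h.sq_sum_sq_le V hT
  have h2 : (V.card : ℝ) ^ 2 - V.card ≤ ∑ l ∈ L, (((B l ∩ V).card : ℝ) ^ 2 - (B l ∩ V).card) := by
    have := card_offDiag_le_of_clique hV
    have h3 : ((V.offDiag.card : ℕ) : ℝ) ≤ ∑ l ∈ L, ((B l ∩ V).offDiag.card : ℝ) := by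
      exact_mod_cast this
    simpa only [cast_offDiag_card] using h3
  rw [Finset.sum_sub_distrib] at h2
  have hY : 0 ≤ ∑ l ∈ L, ((B l ∩ V).card : ℝ) := Finset.sum_nonneg fun _ _ => Nat.cast_nonneg _
  set X := ∑ l ∈ L, ((B l ∩ V).card : ℝ) ^ 2
  set Y := ∑ l ∈ L, ((B l ∩ V).card : ℝ)
  set v : ℝ := (V.card : ℝ)
  have hv : 0 < v := by linarith
  have hX : v * (v - 1) ≤ X := by nlinarith
  have hX0 : 0 ≤ v * (v - 1) := mul_nonneg hv.le (by linarith)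
  -- Since X ≥ v(v - 1) and v - 1 - T ≥ w. The second moment inequality reads X(X - Tv) ≤ vY², so Y²
  -- ≥ v(v - 1)w ≥ w³.
  have h4 : v * w ≤ X - T * v := by nlinarith
  have h5 : (v * (v - 1)) * (v * w) ≤ X * (X - T * v) :=
    mul_le_mul hX h4 (mul_nonneg hv.le hw) (hX0.trans hX)
  have h6 : v * (v * (v - 1) * w) ≤ v * Y ^ 2 := by nlinarith
  have h7 := le_of_mul_le_mul_left h6 hv
  have h8 : w * w ≤ v * (v - 1) := mul_le_mul (by linarith) (by linarith) hw hv.le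
  nlinarith [mul_le_mul_of_nonneg_right h8 hw]

end Basic

/-! ### Transversals, de Bruijn–Erdős and greedy independent sets. -/

section Structure

open scoped Classical

variable {α ι : Type*} {L : Finset ι} {B : ι → Finset α}

/-- An independent set can be extended by one point on each of several lines. -/
theorem exists_transversal (D : ℕ) : ∀ (J : Finset ι) (F : ι → Finset α) (I : Finset α),
    IsIndep L B I → (∀ x ∈ I, ∀ j ∈ J, x ∉ F j) →
    (∀ x ∈ I, ∀ j ∈ J, ∀ y ∈ F j, ¬ Joined L B x y) →
    (∀ j ∈ J, ∀ k ∈ J, j ≠ k → Disjoint (F j) (F k)) →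
    (∀ j ∈ J, ∀ k ∈ J, j ≠ k → ∀ y ∈ F j, ((F k).filter (fun x => Joined L B y x)).card ≤ D) →
    (∀ j ∈ J, D * J.card < (F j).card) →
    ∃ I', IsIndep L B I' ∧ I'.card = I.card + J.card ∧ I' ⊆ I ∪ J.biUnion F := by
  intro J
  induction J using Finset.induction_on with
  | empty => exact fun F I hI _ _ _ _ _ => ⟨I, hI, by simp, by simp⟩
  | insert j J hjJ ih =>
    intro F I hI hIF hIJ hdis hdeg hcard
    have hj := Finset.mem_insert_self j J
    have hpos : 0 < (F j).card := lt_of_le_of_lt (Nat.zero_le _) (hcard j hj)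
    obtain ⟨y, hy⟩ := Finset.card_pos.1 hpos
    have hsub : ∀ {k}, k ∈ J → k ∈ insert j J := fun h => Finset.mem_insert_of_mem h
    have hne : ∀ {k}, k ∈ J → j ≠ k := fun h e => hjJ (e ▸ h)
    -- Move `y` into the independent set and delete from every remaining `F k` the at most D points
    -- joined to `y`. The margin `D * J.card` drops by exactly D, so the induction continues.
    suffices key : ∃ I', IsIndep L B I' ∧ I'.card = (insert y I).card + J.card ∧
        I' ⊆ insert y I ∪ J.biUnion (fun k => (F k).filter (fun x => ¬ Joined L B y x)) by
      obtain ⟨I', h1, h2, h4⟩ := key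
      refine ⟨I', h1, ?_, h4.trans ?_⟩
      · rw [h2, Finset.card_insert_of_notMem hjJ,
          Finset.card_insert_of_notMem fun h => hIF y h j hj hy]
        ring
      · intro x hx
        simp only [Finset.mem_union, Finset.mem_insert, Finset.mem_biUnion,
          Finset.mem_filter] at hx ⊢
        rcases hx with (rfl | hx) | ⟨k, hk, hx, -⟩
        · exact Or.inr ⟨j, Or.inl rfl, hy⟩
        · exact Or.inl hx
        · exact Or.inr ⟨k, Or.inr hk, hx⟩
    refine ih _ _ (hI.insert_point fun x hx => hIJ x hx j hj y hy) ?_ ?_ ?_ ?_ ?_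
    · intro x hx k hk hxk
      rw [Finset.mem_filter] at hxk
      rcases Finset.mem_insert.1 hx with rfl | hx
      · exact Finset.disjoint_left.1 (hdis j hj k (hsub hk) (hne hk)) hy hxk.1
      · exact hIF x hx k (hsub hk) hxk.1
    · intro x hx k hk z hz
      rw [Finset.mem_filter] at hz
      rcases Finset.mem_insert.1 hx with rfl | hx
      · exact hz.2
      · exact hIJ x hx k (hsub hk) z hz.1
    · intro k hk k' hk' hkk
      exact Finset.disjoint_of_subset_left (Finset.filter_subset _ _)
        (Finset.disjoint_of_subset_right (Finset.filter_subset _ _)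
          (hdis k (hsub hk) k' (hsub hk') hkk))
    · intro k hk k' hk' hkk z hz
      rw [Finset.mem_filter] at hz
      refine (Finset.card_le_card ?_).trans (hdeg k (hsub hk) k' (hsub hk') hkk z hz.1)
      exact Finset.filter_subset_filter _ (Finset.filter_subset _ _)
    · intro k hk
      have h1 := hcard k (hsub hk)
      have h2 := hdeg j hj k (hsub hk) (hne hk) y hy
      have h3 := Finset.card_filter_add_card_filter_not (s := F k) (fun x => Joined L B y x)
      rw [Finset.card_insert_of_notMem hjJ, Nat.mul_add] at h1
      omega

/-- The de Bruijn–Erdős theorem for a clique not contained in a line. -/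
theorem IsLinear.card_le_of_clique (h : IsLinear L B) {V : Finset α}
    (hV : ∀ p ∈ V, ∀ q ∈ V, p ≠ q → Joined L B p q) (hV1 : 1 < V.card)
    (hL : ∀ l ∈ L, ¬ V ⊆ B l) : V.card ≤ L.card := by
  let _ : Membership V L := ⟨fun l p => (p : α) ∈ B (l : ι)⟩
  have hmem : ∀ (p : V) (l : L), p ∈ l ↔ (p : α) ∈ B (l : ι) := fun _ _ => Iff.rfl
  have hjoin : ∀ p q : V, p ≠ q → ∃ l : L, p ∈ l ∧ q ∈ l := by
    intro p q hpq
    obtain ⟨l, hl, h1, h2⟩ := hV p p.2 q q.2 (fun e => hpq (Subtype.ext e))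
    exact ⟨⟨l, hl⟩, h1, h2⟩
  choose f hf using hjoin
  have hoff : ∀ l : L, ∃ p : V, p ∉ l := by
    intro l
    obtain ⟨p, hp, hpl⟩ := Finset.not_subset.1 (hL l l.2)
    exact ⟨⟨p, hp⟩, hpl⟩
  have heq : ∀ {p q : V} {l l' : L}, p ∈ l → q ∈ l → p ∈ l' → q ∈ l' → p = q ∨ l = l' := by
    intro p q l l' h1 h2 h3 h4
    rcases h l l.2 l' l'.2 p q h1 h2 h3 h4 with e | e
    · exact Or.inl (Subtype.ext e)
    · exact Or.inr (Subtype.ext e)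
  let _ : Configuration.HasLines V L :=
    { exists_point := hoff
      -- For a line missing `p`: take `x` off the line through `p` and some `q`; the line through
      -- `q` and `x` then avoids `p`.
      exists_line := by
        intro p
        obtain ⟨q, hq, hqp⟩ := Finset.exists_mem_ne hV1 (p : α)
        have hpq : p ≠ ⟨q, hq⟩ := fun e => hqp (by rw [e])
        obtain ⟨x, hx⟩ := hoff (f p ⟨q, hq⟩ hpq)
        have hqx : (⟨q, hq⟩ : V) ≠ x := fun e => hx (e ▸ (hf _ _ hpq).2)
        refine ⟨f ⟨q, hq⟩ x hqx, fun hp => hx ?_⟩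
        rcases heq hp (hf _ _ hqx).1 (hf _ _ hpq).1 (hf _ _ hpq).2 with e | e
        · exact absurd e hpq
        · exact e ▸ (hf _ _ hqx).2
      eq_or_eq := heq
      mkLine := fun {p q} hpq => f p q hpq
      mkLine_ax := fun {p q} hpq => hf p q hpq }
  have := Configuration.HasLines.card_le (P := V) (L := L)
  simpa using this

/-- The points of `V` joined to `p` and different from it. -/
noncomputable def nbhd (L : Finset ι) (B : ι → Finset α) (V : Finset α) (p : α) : Finset α :=
  V.filter (fun x => p ≠ x ∧ Joined L B p x)

/-- Greedy selection of points of minimum degree. -/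
theorem exists_greedy (V : Finset α) : ∀ W ⊆ V, ∃ (S : Finset α) (β : α → ℕ),
    S ⊆ W ∧ IsIndep L B S ∧ W ⊆ S.biUnion (fun p => insert p (nbhd L B V p)) ∧
    ∑ p ∈ S, β p = W.card ∧ (∀ p ∈ S, β p ≤ (nbhd L B V p).card + 1) ∧
    ∑ p ∈ S, β p * (nbhd L B V p).card ≤ ∑ v ∈ W, (nbhd L B V v).card := by
  intro W
  induction W using Finset.strongInduction with
  | H W ih =>
    intro hWV
    rcases W.eq_empty_or_nonempty with rfl | hne
    · exact ⟨∅, fun _ => 0, by simp, by intro p hp; simp at hp, by simp, by simp, by simp, by simp⟩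
    obtain ⟨p, hp, hmin⟩ := Finset.exists_min_image W (fun v => (nbhd L B V v).card) hne
    set N := insert p (nbhd L B V p) with hN
    have hpN : p ∈ N := Finset.mem_insert_self _ _
    have hsub : W \ N ⊂ W := by
      refine Finset.ssubset_iff_subset_ne.2 ⟨Finset.sdiff_subset, fun e => ?_⟩
      have := e.symm ▸ hp
      exact (Finset.mem_sdiff.1 this).2 hpN
    obtain ⟨S, β, h1, h2, h3, h4, h5, h6⟩ := ih _ hsub (hsub.subset.trans hWV)
    have hpS : p ∉ S := fun h => (Finset.mem_sdiff.1 (h1 h)).2 hpN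
    have hβ : ∀ x ∈ S, Function.update β p (W ∩ N).card x = β x := fun x hx =>
      Function.update_of_ne (by rintro rfl; exact hpS hx) _ _
    have hcard := Finset.card_sdiff_add_card_inter W N
    -- `β p` counts the points of `W` covered for the first time by `p`. Each of them has degree at
    -- least that of `p`, which gives the final weighted inequality.
    refine ⟨insert p S, Function.update β p (W ∩ N).card, ?_, ?_, ?_, ?_, ?_, ?_⟩
    · exact Finset.insert_subset hp (h1.trans Finset.sdiff_subset)
    · refine h2.insert_point fun x hx hj => ?_
      have hx' := Finset.mem_sdiff.1 (h1 hx)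
      refine hx'.2 (Finset.mem_insert_of_mem (Finset.mem_filter.2 ⟨hWV hx'.1, ?_, hj.symm⟩))
      rintro rfl
      exact hpS hx
    · intro x hx
      rw [Finset.biUnion_insert, Finset.mem_union]
      by_cases hxN : x ∈ N
      · exact Or.inl hxN
      · exact Or.inr (h3 (Finset.mem_sdiff.2 ⟨hx, hxN⟩))
    · rw [Finset.sum_insert hpS, Function.update_self, Finset.sum_congr rfl hβ, h4]
      omega
    · intro x hx
      rcases Finset.mem_insert.1 hx with rfl | hx
      · rw [Function.update_self]
        exact (Finset.card_le_card Finset.inter_subset_right).trans (Finset.card_insert_le _ _)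
      · rw [hβ x hx]
        exact h5 x hx
    · rw [Finset.sum_insert hpS, Function.update_self,
        Finset.sum_congr rfl (fun x hx => by rw [hβ x hx])]
      rw [← Finset.sum_sdiff (Finset.inter_subset_left : W ∩ N ⊆ W), add_comm]
      refine Nat.add_le_add ?_ ?_
      · rwa [Finset.sdiff_inter_self_left]
      · rw [← smul_eq_mul]
        exact Finset.card_nsmul_le_sum _ _ _ fun x hx => hmin x (Finset.mem_inter.1 hx).1

end Structure

/-! ### Turán stability and independent sets under few short lines. -/

section Asymptotic

open scoped Classical

variable {α ι : Type*} {L : Finset ι} {B : ι → Finset α}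

theorem IsLinear.sum_card_nbhd_le (h : IsLinear L B) (V : Finset α) {T : ℝ} (hT0 : 0 ≤ T)
    (hT : ∀ l ∈ L, ((B l ∩ V).card : ℝ) ≤ T) :
    ∑ v ∈ V, ((nbhd L B V v).card : ℝ) ≤ V.card * (L.card + T) := by
  have h1 : ∑ v ∈ V, ((nbhd L B V v).card : ℝ) ≤ ∑ l ∈ L, ((B l ∩ V).offDiag.card : ℝ) := by
    exact_mod_cast sum_joined_le (L := L) (B := B) V
  refine h1.trans (le_trans (Finset.sum_le_sum fun l _ => ?_) (h.sum_sq_le V hT0 hT))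
  rw [cast_offDiag_card]
  exact sub_le_self _ (Nat.cast_nonneg _)

/-- Numerical stability in the greedy bound: if `r ∑ β x` is nearly as small as possible, then
there are `r` terms, all of them nearly equal, and `x` is close to `β` in the mean. -/
theorem greedy_stability {S : Finset α} {β x : α → ℝ} {N δ : ℝ} {r : ℕ} (hr : 1 ≤ r)
    (hN : 0 < N) (hδ : 400 * r * δ ≤ 1) (hS : S.card ≤ r) (hβ0 : ∀ p ∈ S, 0 ≤ β p)
    (hβx : ∀ p ∈ S, β p ≤ x p) (hsum : ∑ p ∈ S, β p = N)
    (hmul : r * ∑ p ∈ S, β p * x p ≤ (1 + δ) * N ^ 2) :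
    S.card = r ∧ (∀ p ∈ S, 19 / 20 * N ≤ r * β p) ∧
      r * ∑ p ∈ S, (x p - β p) ≤ N / 100 := by
  have hr0 : (1 : ℝ) ≤ r := by exact_mod_cast hr
  have hsq : ∑ p ∈ S, β p ^ 2 ≤ ∑ p ∈ S, β p * x p := Finset.sum_le_sum fun p hp => by
    rw [sq]; exact mul_le_mul_of_nonneg_left (hβx p hp) (hβ0 p hp)
  have hcs := sq_sum_le_card_mul_sum_sq (s := S) (f := β)
  rw [hsum] at hcs
  -- The variance about N/r, scaled by r². The hypotheses bound it by (|S| - r + rδ)N², which is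
  -- negative if |S| < r and at most (N/20)² if |S| = r.
  have hvar : ∑ p ∈ S, (r * β p - N) ^ 2 =
      r * (r * ∑ p ∈ S, β p ^ 2) - 2 * r * N ^ 2 + S.card * N ^ 2 := by
    have : ∀ p, (r * β p - N) ^ 2 = r * r * β p ^ 2 - 2 * r * N * β p + N ^ 2 := fun p => by ring
    simp_rw [this]
    rw [Finset.sum_add_distrib, Finset.sum_sub_distrib, ← Finset.mul_sum, ← Finset.mul_sum, hsum]
    simp
    ring
  have hN2 : 0 < N ^ 2 := by positivity
  have h1 : r * ∑ p ∈ S, β p ^ 2 ≤ (1 + δ) * N ^ 2 :=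
    (mul_le_mul_of_nonneg_left hsq (by linarith)).trans hmul
  have h2 : ∑ p ∈ S, (r * β p - N) ^ 2 ≤ (S.card - r + r * δ) * N ^ 2 := by
    rw [hvar]
    nlinarith [mul_le_mul_of_nonneg_left h1 (show (0 : ℝ) ≤ r by linarith)]
  have h3 : 0 ≤ ∑ p ∈ S, (r * β p - N) ^ 2 := Finset.sum_nonneg fun _ _ => sq_nonneg _
  have h4 : S.card = r := by
    by_contra hne
    have h5 : S.card + 1 ≤ r := by omega
    have h6 : (S.card : ℝ) + 1 ≤ r := by exact_mod_cast h5
    have h7 : ((S.card : ℝ) - r + r * δ) * N ^ 2 < 0 :=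
      mul_neg_of_neg_of_pos (by linarith) hN2
    linarith
  have hcard : (S.card : ℝ) = r := by rw [h4]
  rw [hcard] at h2 hcs
  have h5 : ∀ p ∈ S, 19 / 20 * N ≤ r * β p := by
    intro p hp
    have h6 := Finset.single_le_sum (f := fun p => (r * β p - N) ^ 2)
      (fun _ _ => sq_nonneg _) hp
    have h7 : (r * β p - N) ^ 2 ≤ (N / 20) ^ 2 := by
      refine (h6.trans h2).trans ?_
      have : (r - r + r * δ) ≤ 1 / 400 := by linarith
      calc _ ≤ 1 / 400 * N ^ 2 := mul_le_mul_of_nonneg_right this hN2.le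
        _ = _ := by ring
    have h8 := abs_le_of_sq_le_sq' h7 (by linarith)
    linarith [h8.1]
  refine ⟨h4, h5, ?_⟩
  -- As rβ ≥ N/2 on `S`, the excess x - β is controlled by r∑(βx - β²), which is at most δN² because
  -- r∑β² ≥ N² by Cauchy–Schwarz.
  have h6 : N / 2 * ∑ p ∈ S, (x p - β p) ≤ r * ∑ p ∈ S, (β p * x p - β p ^ 2) := by
    rw [Finset.mul_sum, Finset.mul_sum]
    refine Finset.sum_le_sum fun p hp => ?_
    have h7 : N / 2 ≤ r * β p := by linarith [h5 p hp]
    have := mul_le_mul_of_nonneg_right h7 (sub_nonneg.2 (hβx p hp))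
    linarith
  rw [Finset.sum_sub_distrib (fun p => β p * x p), mul_sub (r : ℝ)] at h6
  have h7 : N / 2 * ∑ p ∈ S, (x p - β p) ≤ δ * N ^ 2 := by linarith
  have h8 : N * (r * ∑ p ∈ S, (x p - β p)) ≤ N * (N / 100) := by
    have h9 := mul_le_mul_of_nonneg_left h7 (show (0 : ℝ) ≤ 2 * r by linarith)
    have h10 : 400 * r * δ * N ^ 2 ≤ 1 * N ^ 2 := mul_le_mul_of_nonneg_right hδ hN2.le
    linarith
  exact le_of_mul_le_mul_left h8 hN

/-- If `I` is a maximum independent set, the points joined to exactly one `p ∈ I` and equal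
to no other point of `I` form a clique. -/
theorem IsIndep.clique_of_maximum {I V : Finset α} (hI : IsIndep L B I) (hIV : I ⊆ V) {r : ℕ}
    (hcard : I.card = r) (hmax : ∀ I' ⊆ V, IsIndep L B I' → I'.card ≤ r) {p : α} (hp : p ∈ I)
    {x y : α} (hx : x ∈ V) (hy : y ∈ V) (hxy : x ≠ y)
    (hxI : ∀ q ∈ I.erase p, x ≠ q ∧ ¬ Joined L B q x)
    (hyI : ∀ q ∈ I.erase p, y ≠ q ∧ ¬ Joined L B q y) : Joined L B x y := by
  by_contra hj
  -- Exchanging `p` for two unjoined points would enlarge the maximum independent set.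
  have h1 : IsIndep L B (insert y (insert x (I.erase p))) := by
    refine ((hI.mono (Finset.erase_subset _ _)).insert_point fun q hq => (hxI q hq).2).insert_point ?_
    intro q hq
    rcases Finset.mem_insert.1 hq with rfl | hq
    · exact hj
    · exact (hyI q hq).2
  have h2 := hmax _ (Finset.insert_subset hy (Finset.insert_subset hx
    ((Finset.erase_subset _ _).trans hIV))) h1
  rw [Finset.card_insert_of_notMem, Finset.card_insert_of_notMem, Finset.card_erase_of_mem hp]
    at h2
  · have := Finset.card_pos.2 ⟨p, hp⟩
    omega
  · exact fun h => (hxI x h).1 rfl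
  · intro h
    rcases Finset.mem_insert.1 h with h | h
    · exact hxy h.symm
    · exact (hyI y h).1 rfl

/-- A system of about `|V| / r` short lines on `V`, `r ≥ 2`, leaves an independent set of size
`r + 1`. -/
theorem IsLinear.exists_indep_of_few_lines (h : IsLinear L B) (V : Finset α) {r : ℕ} (hr : 2 ≤ r)
    {ε T : ℝ} (hε : 1200 * r ^ 2 * ε ≤ 1) (hN : 1 ≤ ε * V.card) (hT0 : 0 ≤ T)
    (hT1 : T ≤ ε * V.card) (hL : r * (L.card : ℝ) ≤ (1 + ε) * V.card)
    (hT : ∀ l ∈ L, ((B l ∩ V).card : ℝ) ≤ T) :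
    ∃ I ⊆ V, IsIndep L B I ∧ I.card = r + 1 := by
  by_contra hcon
  have hmax : ∀ I ⊆ V, IsIndep L B I → I.card ≤ r := by
    intro I hIV hI
    by_contra hlt
    obtain ⟨I', h1, h2⟩ := Finset.exists_subset_card_eq (show r + 1 ≤ I.card by omega)
    exact hcon ⟨I', h1.trans hIV, hI.mono h1, h2⟩
  set N : ℝ := (V.card : ℝ) with hNdef
  have hN0 : 0 ≤ N := Nat.cast_nonneg _
  have hNpos : 0 < N := by
    rcases hN0.eq_or_lt with h0 | h0
    · rw [← h0] at hN; norm_num at hN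
    · exact h0
  have hε0 : 0 < ε := by
    by_contra hneg
    have := mul_nonpos_of_nonpos_of_nonneg (not_lt.1 hneg) hN0
    linarith
  have hr2 : (2 : ℝ) ≤ r := by exact_mod_cast hr
  have hrε : 1200 * r * (r * ε) ≤ 1 := by nlinarith
  have hrε' : 2400 * (r * ε) ≤ 1 := by
    have : 0 ≤ r * ε := by positivity
    nlinarith
  have hm0 : (0 : ℝ) ≤ L.card := Nat.cast_nonneg _
  obtain ⟨S, β, hSV, hS, hcov, hsum, hβ, hdeg⟩ := exists_greedy (L := L) (B := B) V V subset_rfl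
  have hdeg1 : ∑ p ∈ S, (β p : ℝ) * ((nbhd L B V p).card : ℝ) ≤ N * (L.card + T) := by
    refine le_trans ?_ (h.sum_card_nbhd_le V hT0 hT)
    exact_mod_cast hdeg
  have hsum' : ∑ p ∈ S, (β p : ℝ) = N := by
    rw [hNdef, ← hsum, Nat.cast_sum]
  obtain ⟨hcard, hβlow, hclose⟩ := greedy_stability (S := S) (β := fun p => (β p : ℝ))
    (x := fun p => ((nbhd L B V p).card : ℝ) + 1) (δ := 3 * (r * ε)) (r := r) (by omega) hNpos
    (by linarith) (hmax S hSV hS) (fun _ _ => Nat.cast_nonneg _)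
    (fun p hp => by exact_mod_cast hβ p hp) hsum' (by
      have : ∑ p ∈ S, (β p : ℝ) * (((nbhd L B V p).card : ℝ) + 1) =
          ∑ p ∈ S, (β p : ℝ) * ((nbhd L B V p).card : ℝ) + N := by
        rw [← hsum', ← Finset.sum_add_distrib]
        exact Finset.sum_congr rfl fun p _ => by ring
      rw [this]
      -- The error in the line count, T and the 1 each cost at most rεN; hence δ = 3rε.
      have h1 : r * ((L.card : ℝ) + T + 1) ≤ (1 + 3 * (r * ε)) * N := by nlinarith
      have h2 := mul_le_mul_of_nonneg_left h1 hN0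
      have h3 := mul_le_mul_of_nonneg_left hdeg1 (show (0 : ℝ) ≤ r by linarith)
      linarith)
  set N' : α → Finset α := fun p => insert p (nbhd L B V p) with hN'
  -- The points covered by `p` alone. These sets are disjoint cliques, and |U p| ≥ β p minus the
  -- total excess of the closed neighbourhoods over β.
  set U : α → Finset α := fun p => V \ (S.erase p).biUnion N' with hU
  have hN'card : ∀ p, ((N' p).card : ℝ) ≤ ((nbhd L B V p).card : ℝ) + 1 := fun p => by
    exact_mod_cast Finset.card_insert_le _ _
  have hUmem : ∀ p x, x ∈ U p → x ∈ V ∧ ∀ q ∈ S.erase p, x ≠ q ∧ ¬ Joined L B q x := by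
    intro p x hx
    rw [hU, Finset.mem_sdiff, Finset.mem_biUnion] at hx
    refine ⟨hx.1, fun q hq => ?_⟩
    have hxq : x ≠ q := by
      rintro rfl
      exact hx.2 ⟨x, hq, Finset.mem_insert_self _ _⟩
    refine ⟨hxq, fun hj => hx.2 ⟨q, hq, Finset.mem_insert_of_mem ?_⟩⟩
    exact Finset.mem_filter.2 ⟨hx.1, hxq.symm, hj⟩
  have hUdis : (S : Set α).PairwiseDisjoint U := by
    intro p hp q hq hpq
    rw [Function.onFun, Finset.disjoint_left]
    intro x hxp hxq
    rw [hU, Finset.mem_sdiff, Finset.mem_biUnion] at hxp hxq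
    obtain ⟨z, hz, hxz⟩ := Finset.mem_biUnion.1 (hcov hxp.1)
    by_cases hzp : z = p
    · exact hxq.2 ⟨z, Finset.mem_erase.2 ⟨fun e => hpq (hzp ▸ e), hz⟩, hxz⟩
    · exact hxp.2 ⟨z, Finset.mem_erase.2 ⟨hzp, hz⟩, hxz⟩
  -- Multiplied by r: at least 0.95N from β p, at most 0.01N lost to the excess and N/1200 to T + 1,
  -- which leaves more than 0.93N.
  set w : ℝ := 93 / 100 * (N / r) with hw
  have hNr : N / r * r = N := div_mul_cancel₀ _ (by linarith)
  have hNr0 : 0 ≤ N / r := by positivity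
  have hUcard : ∀ p ∈ S, w + T + 1 ≤ (U p).card := by
    intro p hp
    have h1 : (V.card : ℝ) ≤ (U p).card + ∑ q ∈ S.erase p, ((N' q).card : ℝ) := by
      have h2 := Finset.card_le_card_sdiff_add_card (s := V) (t := (S.erase p).biUnion N')
      have h3 := Finset.card_biUnion_le (s := S.erase p) (t := N')
      exact_mod_cast h2.trans (Nat.add_le_add_left h3 _)
    have h2 : ∑ q ∈ S.erase p, ((N' q).card : ℝ) ≤
        ∑ q ∈ S.erase p, ((((nbhd L B V q).card : ℝ) + 1 - β q) + β q) :=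
      Finset.sum_le_sum fun q _ => by linarith [hN'card q]
    rw [Finset.sum_add_distrib] at h2
    have h3 : ∑ q ∈ S.erase p, (((nbhd L B V q).card : ℝ) + 1 - β q) ≤
        ∑ q ∈ S, (((nbhd L B V q).card : ℝ) + 1 - β q) := by
      refine Finset.sum_le_sum_of_subset_of_nonneg (Finset.erase_subset _ _) fun q hq _ => ?_
      have : (β q : ℝ) ≤ ((nbhd L B V q).card : ℝ) + 1 := by exact_mod_cast hβ q hq
      linarith
    have h4 := Finset.add_sum_erase S (fun q => (β q : ℝ)) hp
    rw [hsum'] at h4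
    have h5 : (β p : ℝ) - ∑ q ∈ S, (((nbhd L B V q).card : ℝ) + 1 - β q) ≤ (U p).card := by
      linarith
    have h6 := hβlow p hp
    have h7 : r * (w + T + 1) ≤ r * ((U p).card : ℝ) := by
      have h8 := mul_le_mul_of_nonneg_left h5 (show (0 : ℝ) ≤ r by linarith)
      have h9 : r * T ≤ r * (ε * N) := mul_le_mul_of_nonneg_left hT1 (by linarith)
      have h10 : (r : ℝ) * 1 ≤ r * (ε * N) := mul_le_mul_of_nonneg_left hN (by linarith)
      have h11 : 2400 * (r * ε) * N ≤ 1 * N := mul_le_mul_of_nonneg_right hrε' hN0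
      have h12 : r * w = 93 / 100 * N := by rw [hw]; linear_combination 93 / 100 * hNr
      linarith
    exact le_of_mul_le_mul_left h7 (by linarith)
  have hw0 : 0 ≤ w := by positivity
  have hY : ∀ p ∈ S, √(w ^ 3) ≤ ∑ l ∈ L, ((B l ∩ U p).card : ℝ) := by
    intro p hp
    refine Real.sqrt_le_iff.2 ⟨Finset.sum_nonneg fun _ _ => Nat.cast_nonneg _, ?_⟩
    refine h.le_sq_sum_of_clique hT0 (fun l hl => le_trans ?_ (hT l hl)) ?_ hw0 (hUcard p hp)
    · exact_mod_cast Finset.card_le_card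
        (Finset.inter_subset_inter_left Finset.sdiff_subset)
    · intro x hx y hy hxy
      exact hS.clique_of_maximum hSV hcard hmax hp (hUmem p x hx).1 (hUmem p y hy).1 hxy
        (hUmem p x hx).2 (hUmem p y hy).2
  have hYsum : r * √(w ^ 3) ≤ ∑ l ∈ L, ((B l ∩ V).card : ℝ) := by
    calc (r : ℝ) * √(w ^ 3) = ∑ p ∈ S, √(w ^ 3) := by simp [hcard]
      _ ≤ ∑ p ∈ S, ∑ l ∈ L, ((B l ∩ U p).card : ℝ) := Finset.sum_le_sum hY
      _ = ∑ l ∈ L, ∑ p ∈ S, ((B l ∩ U p).card : ℝ) := Finset.sum_comm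
      _ ≤ _ := by
        refine Finset.sum_le_sum fun l _ => ?_
        have h1 : ∑ p ∈ S, (B l ∩ U p).card ≤ (B l ∩ V).card := by
          rw [← Finset.card_biUnion]
          · refine Finset.card_le_card (Finset.biUnion_subset.2 fun p _ => ?_)
            exact Finset.inter_subset_inter_left Finset.sdiff_subset
          · intro p hp q hq hpq
            exact Finset.disjoint_of_subset_left Finset.inter_subset_right
              (Finset.disjoint_of_subset_right Finset.inter_subset_right (hUdis hp hq hpq))
        exact_mod_cast h1
  have hYsq := sq_sum_le_card_mul_sum_sq (s := L) (f := fun l => ((B l ∩ V).card : ℝ))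
  have hX := h.sum_sq_le V hT0 hT
  have h1 : (r * √(w ^ 3)) ^ 2 ≤ L.card * (N * (L.card + T)) :=
    (pow_le_pow_left₀ (by positivity) hYsum 2).trans
      (hYsq.trans (mul_le_mul_of_nonneg_left hX hm0))
  rw [mul_pow, Real.sq_sqrt (by positivity)] at h1
  have hrm : r * (L.card : ℝ) ≤ 11 / 10 * N := by
    have : ε ≤ 1 / 10 := by nlinarith
    exact hL.trans (mul_le_mul_of_nonneg_right (by linarith) hN0)
  have hrmT : r * ((L.card : ℝ) + T) ≤ 11 / 10 * N := by
    have h9 : r * T ≤ r * (ε * N) := mul_le_mul_of_nonneg_left hT1 (by linarith)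
    have h11 : (ε + r * ε) * N ≤ 1 / 10 * N := mul_le_mul_of_nonneg_right (by nlinarith) hN0
    linarith
  have h2 : (r * (L.card : ℝ)) * (r * ((L.card : ℝ) + T)) ≤ (11 / 10 * N) * (11 / 10 * N) :=
    mul_le_mul hrm hrmT (by positivity) (by positivity)
  have h3 : (r : ℝ) ^ 2 * ((r : ℝ) ^ 2 * w ^ 3) ≤ 121 / 100 * N ^ 3 := by
    calc (r : ℝ) ^ 2 * ((r : ℝ) ^ 2 * w ^ 3) ≤ (r : ℝ) ^ 2 * (L.card * (N * (L.card + T))) :=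
        mul_le_mul_of_nonneg_left h1 (by positivity)
      _ = N * ((r * (L.card : ℝ)) * (r * ((L.card : ℝ) + T))) := by ring
      _ ≤ N * ((11 / 10 * N) * (11 / 10 * N)) := mul_le_mul_of_nonneg_left h2 hN0
      _ = _ := by ring
  have h4 : (r : ℝ) ^ 2 * ((r : ℝ) ^ 2 * w ^ 3) = r * ((93 / 100) ^ 3 * N ^ 3) := by
    have h5 : r * w = 93 / 100 * N := by rw [hw]; linear_combination 93 / 100 * hNr
    calc (r : ℝ) ^ 2 * ((r : ℝ) ^ 2 * w ^ 3) = r * (r * w) ^ 3 := by ring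
      _ = _ := by rw [h5]; ring
  have hN3 : 0 < N ^ 3 := by positivity
  rw [h4] at h3
  -- The cliques need incidences worth r·0.93³N³, while the lines allow only 1.21N³. Since 2·0.93³ >
  -- 1.21, this is impossible for r ≥ 2.
  have h5 := mul_le_mul_of_nonneg_right hr2 (show 0 ≤ (93 / 100 : ℝ) ^ 3 * N ^ 3 by positivity)
  linarith

end Asymptotic

/-! ### Long lines: the extension principle and the extremal cases. -/

section LowerBound

open scoped Classical

variable {α ι : Type*} {L : Finset ι} {B : ι → Finset α} {P : Finset α} {k D : ℕ}

/-- If there is no independent set of more than `k` points, then points off some lines which,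
together with these lines, number more than `k` have large total degree. -/
theorem IsLinear.exists_card_le_sum_lineDeg (h : IsLinear L B) (hBP : ∀ l ∈ L, B l ⊆ P)
    (hcov : ∀ I ⊆ P, IsIndep L B I → I.card ≤ k) (hD : L.card ≤ D * D) (hD0 : 0 < D)
    {J : Finset ι} (hJ : J ⊆ L) {I : Finset α} (hIP : I ⊆ P) (hI : IsIndep L B I)
    (hoff : ∀ x ∈ I, ∀ j ∈ J, x ∉ B j) (hcard : k < I.card + J.card) :
    ∃ j ∈ J, (B j).card ≤ ∑ q ∈ I, lineDeg L B q + D + J.card + D * J.card := by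
  by_contra! hlt
  -- The usable points of `j`. At most D are lost to high degree, |J| to the other lines of `J`, and
  -- the degree sum of `I` to points joined to `I`. If every line of `J` were longer than claimed, a
  -- transversal would extend `I` beyond k points.
  set F : ι → Finset α := fun j => (B j).filter (fun y => lineDeg L B y ≤ D ∧
    (∀ i ∈ J, i ≠ j → y ∉ B i) ∧ ∀ q ∈ I, ¬ Joined L B q y) with hF
  have hFB : ∀ j, F j ⊆ B j := fun j => Finset.filter_subset _ _
  have hFcard : ∀ j ∈ J, D * J.card < (F j).card := by
    intro j hj
    have hsub : B j ⊆ F j ∪ ((B j).filter (fun y => D < lineDeg L B y) ∪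
        ((J.erase j).biUnion (fun i => B i ∩ B j) ∪
          I.biUnion (fun q => (B j).filter (fun y => Joined L B q y)))) := by
      intro y hy
      by_contra hcon
      simp only [hF, Finset.mem_union, Finset.mem_filter, Finset.mem_biUnion, Finset.mem_inter,
        Finset.mem_erase, hy, true_and, and_true, not_or, not_exists, not_and] at hcon
      exact hcon.1 (not_lt.1 hcon.2.1) (fun i hi hne => hcon.2.2.1 i ⟨hne, hi⟩) hcon.2.2.2
    have h1 : ((B j).filter (fun y => D < lineDeg L B y)).card ≤ D :=
      Nat.le_of_mul_le_mul_right ((h.card_lineDeg_gt (hJ hj) D).trans hD) hD0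
    have h2 : ((J.erase j).biUnion (fun i => B i ∩ B j)).card ≤ J.card := by
      refine (Finset.card_biUnion_le_card_mul _ _ 1 fun i hi => ?_).trans ?_
      · rw [Finset.mem_erase] at hi
        exact h.card_inter_le_one (hJ hi.2) (hJ hj) hi.1
      · simpa using Finset.card_le_card (Finset.erase_subset j J)
    have h3 : (I.biUnion (fun q => (B j).filter (fun y => Joined L B q y))).card ≤
        ∑ q ∈ I, lineDeg L B q :=
      Finset.card_biUnion_le.trans
        (Finset.sum_le_sum fun q hq => h.card_joined_le (hJ hj) (hoff q hq j hj))
    have h4 := Finset.card_le_card hsub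
    have h5 := Finset.card_union_le (F j) ((B j).filter (fun y => D < lineDeg L B y) ∪
        ((J.erase j).biUnion (fun i => B i ∩ B j) ∪
          I.biUnion (fun q => (B j).filter (fun y => Joined L B q y))))
    have h6 := Finset.card_union_le ((B j).filter (fun y => D < lineDeg L B y))
        ((J.erase j).biUnion (fun i => B i ∩ B j) ∪
          I.biUnion (fun q => (B j).filter (fun y => Joined L B q y)))
    have h7 := Finset.card_union_le ((J.erase j).biUnion (fun i => B i ∩ B j))
          (I.biUnion (fun q => (B j).filter (fun y => Joined L B q y)))
    have h8 := hlt j hj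
    omega
  have hFmem : ∀ {j y}, y ∈ F j → y ∈ B j ∧ lineDeg L B y ≤ D ∧
      (∀ i ∈ J, i ≠ j → y ∉ B i) ∧ ∀ q ∈ I, ¬ Joined L B q y := fun hy => Finset.mem_filter.1 hy
  obtain ⟨I', h1, h2, h3⟩ := exists_transversal D J F I hI
    (fun x hx j hj hxj => hoff x hx j hj (hFB j hxj))
    (fun x hx j _ y hy => (hFmem hy).2.2.2 x hx)
    (fun i _ j hj hij => Finset.disjoint_left.2 fun y hyi hyj =>
      (hFmem hyi).2.2.1 j hj hij.symm (hFB j hyj))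
    (fun i _ j hj hij y hy => by
      refine (Finset.card_le_card (Finset.filter_subset_filter _ (hFB j))).trans ?_
      exact (h.card_joined_le (hJ hj) ((hFmem hy).2.2.1 j hj hij.symm)).trans (hFmem hy).2.1)
    hFcard
  have h4 := hcov I' (h3.trans (Finset.union_subset hIP
    (Finset.biUnion_subset.2 fun j hj => (hFB j).trans (hBP j (hJ hj))))) h1
  omega

/-- The points of `P` on none of the lines in `J`. -/
noncomputable def offPoints (B : ι → Finset α) (P : Finset α) (J : Finset ι) : Finset α :=
  P.filter (fun p => ∀ j ∈ J, p ∉ B j)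

theorem mem_offPoints {J : Finset ι} {p : α} :
    p ∈ offPoints B P J ↔ p ∈ P ∧ ∀ j ∈ J, p ∉ B j := Finset.mem_filter

theorem offPoints_subset {J : Finset ι} : offPoints B P J ⊆ P := Finset.filter_subset _ _

theorem subset_offPoints_union (J : Finset ι) : P ⊆ offPoints B P J ∪ J.biUnion B := by
  intro p hp
  by_cases hj : ∃ j ∈ J, p ∈ B j
  · exact Finset.mem_union_right _ (Finset.mem_biUnion.2 hj)
  · push Not at hj
    exact Finset.mem_union_left _ (mem_offPoints.2 ⟨hp, hj⟩)

theorem card_le_card_offPoints_add (J : Finset ι) :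
    (P.card : ℝ) ≤ (offPoints B P J).card + ∑ j ∈ J, ((B j).card : ℝ) := by
  have h1 := (Finset.card_le_card (subset_offPoints_union (B := B) (P := P) J)).trans
    (Finset.card_union_le _ _)
  have h2 := Finset.card_biUnion_le (s := J) (t := B)
  exact_mod_cast h1.trans (Nat.add_le_add_left h2 _)

theorem sum_card_le {J : Finset ι} {t : ℝ} (ht : ∀ l ∈ J, ((B l).card : ℝ) ≤ t) :
    ∑ j ∈ J, ((B j).card : ℝ) ≤ J.card * t := by
  simpa using Finset.sum_le_card_nsmul J _ t ht

/-- Singling out `j` turns a count of all points into a lower bound for the size of that one line.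
-/
theorem sum_card_le' {J : Finset ι} {t : ℝ} (ht : ∀ l ∈ J, ((B l).card : ℝ) ≤ t) {j : ι}
    (hj : j ∈ J) : ∑ j ∈ J, ((B j).card : ℝ) ≤ (B j).card + (J.card - 1) * t := by
  rw [← Finset.add_sum_erase J _ hj]
  have h1 := sum_card_le (J := J.erase j) (fun l hl => ht l (Finset.mem_of_mem_erase hl))
  rw [Finset.cast_card_erase_of_mem hj] at h1
  linarith

/-- No line through `p` belongs to `J`, so discarding `J` does not affect which points are joined to
`p`. -/
theorem joined_sdiff_iff {J : Finset ι} {p q : α} (hp : ∀ j ∈ J, p ∉ B j) :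
    Joined (L \ J) B p q ↔ Joined L B p q := by
  constructor
  · rintro ⟨l, hl, h1, h2⟩
    exact ⟨l, (Finset.mem_sdiff.1 hl).1, h1, h2⟩
  · rintro ⟨l, hl, h1, h2⟩
    exact ⟨l, Finset.mem_sdiff.2 ⟨hl, fun hj => hp l hj h1⟩, h1, h2⟩

theorem eq_of_lineDeg_le_one {y : α} {i j : ι} (hy : lineDeg L B y ≤ 1) (hi : i ∈ L)
    (hyi : y ∈ B i) (hj : j ∈ L) (hyj : y ∈ B j) : i = j :=
  Finset.card_le_one.1 hy i (Finset.mem_filter.2 ⟨hi, hyi⟩) j (Finset.mem_filter.2 ⟨hj, hyj⟩)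

/-- If `k` lines cover all but one of the points, there are at least `t` further lines. -/
theorem IsLinear.le_card_of_offPoints_eq_singleton (h : IsLinear L B) (hBP : ∀ l ∈ L, B l ⊆ P)
    (hcov : ∀ I ⊆ P, IsIndep L B I → I.card ≤ k) {t : ℝ} (hn : (P.card : ℝ) = k * t + 1)
    (ht : ∀ l ∈ L, ((B l).card : ℝ) ≤ t) {J : Finset ι} (hJ : J ⊆ L) (hJk : J.card = k) {z : α}
    (hz : offPoints B P J = {z}) : t + k ≤ L.card := by
  by_contra! hlt
  have htJ : ∀ l ∈ J, ((B l).card : ℝ) ≤ t := fun l hl => ht l (hJ hl)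
  have hP := card_le_card_offPoints_add (B := B) (P := P) J
  rw [hz, Finset.card_singleton, Nat.cast_one, hn] at hP
  have hfull : ∀ j ∈ J, t ≤ (B j).card := by
    intro j hj
    have := sum_card_le' htJ hj
    rw [hJk] at this
    linarith
  -- A point on two lines of `J` would be counted twice, leaving at most kt points in all, one too
  -- few.
  have hdis : ∀ i ∈ J, ∀ j ∈ J, i ≠ j → ∀ y ∈ B i, y ∉ B j := by
    intro i hi j hj hij y hyi hyj
    have hsub : P ⊆ {z} ∪ ((J.erase j).biUnion B ∪ (B j).erase y) := by
      intro p hp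
      have := subset_offPoints_union (B := B) J hp
      rw [hz] at this
      simp only [Finset.mem_union, Finset.mem_singleton, Finset.mem_biUnion, Finset.mem_erase]
        at this ⊢
      rcases this with h1 | ⟨l, hl, hpl⟩
      · exact Or.inl h1
      · by_cases hlj : l = j
        · subst hlj
          by_cases hpy : p = y
          · exact Or.inr (Or.inl ⟨i, ⟨hij, hi⟩, hpy ▸ hyi⟩)
          · exact Or.inr (Or.inr ⟨hpy, hpl⟩)
        · exact Or.inr (Or.inl ⟨l, ⟨hlj, hl⟩, hpl⟩)
    have h1 := (Finset.card_le_card hsub).trans (Finset.card_union_le _ _)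
    have h2 := Finset.card_union_le ((J.erase j).biUnion B) ((B j).erase y)
    have h3 := Finset.card_biUnion_le (s := J.erase j) (t := B)
    have h4 := Finset.card_erase_add_one hyj
    rw [Finset.card_singleton] at h1
    have h5 : P.card ≤ ∑ i ∈ J.erase j, (B i).card + (B j).card := by omega
    rw [Finset.sum_erase_add _ _ hj] at h5
    have h6 : (P.card : ℝ) ≤ ∑ i ∈ J, ((B i).card : ℝ) := by exact_mod_cast h5
    have h7 := sum_card_le htJ
    rw [hJk] at h7
    linarith
  set F : ι → Finset α := fun j => (B j).filter (fun y => lineDeg L B y ≤ 1) with hF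
  have hFB : ∀ j, F j ⊆ B j := fun j => Finset.filter_subset _ _
  have honly : ∀ {j y l}, j ∈ J → y ∈ F j → l ∈ L → y ∈ B l → l = j := by
    intro j y l hj hy hl hyl
    have hy' := Finset.mem_filter.1 hy
    exact eq_of_lineDeg_le_one hy'.2 hl hyl (hJ hj) hy'.1
  have hz' := mem_offPoints.1 (hz ▸ Finset.mem_singleton_self z)
  -- Points of `F j` lie on no line but `j`, so the transversal has no conflicts (D = 0) and each `F
  -- j` only has to be nonempty. Otherwise every point of `j` lies on a line outside `J`, a
  -- different one each time, which requires at least t lines outside `J`.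
  obtain ⟨I', h1, h2, h3⟩ := exists_transversal (L := L) (B := B) 0 J F {z}
    (by intro p hp q hq hpq; simp_all)
    (by
      intro x hx j hj hxj
      rw [Finset.mem_singleton] at hx
      exact hz'.2 j hj (hFB j (hx ▸ hxj)))
    (by
      rintro x hx j hj y hy ⟨l, hl, hxl, hyl⟩
      rw [Finset.mem_singleton] at hx
      rw [honly hj hy hl hyl, hx] at hxl
      exact hz'.2 j hj hxl)
    (fun i hi j hj hij => Finset.disjoint_left.2 fun y hyi hyj =>
      hdis i hi j hj hij y (hFB i hyi) (hFB j hyj))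
    (by
      intro i hi j hj hij y hy
      rw [Nat.le_zero, Finset.card_eq_zero, Finset.filter_eq_empty_iff]
      rintro x hx ⟨l, hl, hyl, hxl⟩
      rw [honly hi hy hl hyl] at hxl
      exact hdis i hi j hj hij x hxl (hFB j hx))
    (by
      intro j hj
      rw [zero_mul]
      by_contra! h0
      have hsub : B j ⊆ F j ∪ (L \ J).biUnion (fun l => B l ∩ B j) := by
        intro y hy
        by_cases hd : lineDeg L B y ≤ 1
        · exact Finset.mem_union_left _ (Finset.mem_filter.2 ⟨hy, hd⟩)
        · obtain ⟨l, hl, hlj⟩ := Finset.exists_mem_ne (not_le.1 hd) j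
          rw [Finset.mem_filter] at hl
          refine Finset.mem_union_right _ (Finset.mem_biUnion.2 ⟨l, Finset.mem_sdiff.2
            ⟨hl.1, fun hlJ => ?_⟩, Finset.mem_inter.2 ⟨hl.2, hy⟩⟩)
          exact hdis l hlJ j hj hlj y hl.2 hy
      have h4 := (Finset.card_le_card hsub).trans (Finset.card_union_le _ _)
      have h5 : ((L \ J).biUnion (fun l => B l ∩ B j)).card ≤ (L \ J).card * 1 := by
        refine Finset.card_biUnion_le_card_mul _ _ 1 fun l hl => ?_
        rw [Finset.mem_sdiff] at hl
        exact h.card_inter_le_one hl.1 (hJ hj) fun e => hl.2 (e ▸ hj)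
      have h6 := Finset.card_sdiff_add_card_eq_card hJ
      have h7 : (B j).card + k ≤ L.card := by omega
      have h8 : ((B j).card : ℝ) + k ≤ L.card := by exact_mod_cast h7
      linarith [hfull j hj])
  have h4 := hcov I' (h3.trans (Finset.union_subset (Finset.singleton_subset_iff.2 hz'.1)
    (Finset.biUnion_subset.2 fun j hj => (hFB j).trans (hBP j (hJ hj))))) h1
  rw [Finset.card_singleton] at h2
  omega

/-- The case of `k` long lines. -/
theorem IsLinear.le_card_of_long_eq (h : IsLinear L B) (hBP : ∀ l ∈ L, B l ⊆ P)
    (hcov : ∀ I ⊆ P, IsIndep L B I → I.card ≤ k) {t : ℝ} (hn : (P.card : ℝ) = k * t + 1)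
    (ht : ∀ l ∈ L, ((B l).card : ℝ) ≤ t) {J : Finset ι} (hJ : J ⊆ L) (hJk : J.card = k) {d e : ℝ}
    (hR : ((offPoints B P J).card : ℝ) ≤ d)
    (hdeg : ∀ q ∈ offPoints B P J, ∃ j ∈ J, ((B j).card : ℝ) ≤ lineDeg L B q + e)
    (hbig : k + 2 * d + 2 * e ≤ t) : t + k ≤ L.card := by
  have htJ : ∀ l ∈ J, ((B l).card : ℝ) ≤ t := fun l hl => ht l (hJ hl)
  have hP := card_le_card_offPoints_add (B := B) (P := P) J
  rw [hn] at hP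
  have hpos : 0 < (offPoints B P J).card := by
    have h1 := sum_card_le htJ
    rw [hJk] at h1
    have : (0 : ℝ) < (offPoints B P J).card := by linarith
    exact_mod_cast this
  rcases Nat.lt_or_ge 1 (offPoints B P J).card with h1 | h1
  · obtain ⟨p, q, hp, hq, hpq⟩ := Finset.one_lt_card_iff.1 h1
    -- At most d points lie off `J`, so every line of `J` has at least t + 1 - d points.
    have hlow : ∀ q ∈ offPoints B P J, t + 1 - d - e ≤ lineDeg L B q := by
      intro q hq
      obtain ⟨j, hj, hjq⟩ := hdeg q hq
      have h2 := sum_card_le' htJ hj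
      rw [hJk] at h2
      linarith
    have h2 := h.card_mul_le (Z := {p, q}) (d := min (lineDeg L B p) (lineDeg L B q)) (by
      intro x hx
      rw [Finset.mem_insert, Finset.mem_singleton] at hx
      rcases hx with rfl | rfl
      · exact min_le_left _ _
      · exact min_le_right _ _)
    rw [Finset.card_pair hpq] at h2
    have h3 : t + 1 - d - e ≤ (min (lineDeg L B p) (lineDeg L B q) : ℕ) := by
      rw [Nat.cast_min]
      exact le_min (hlow p hp) (hlow q hq)
    have h4 : (2 : ℝ) * (min (lineDeg L B p) (lineDeg L B q) : ℕ) + 2 ≤ L.card + 4 := by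
      exact_mod_cast h2
    linarith
  · obtain ⟨z, hz⟩ := Finset.card_eq_one.1 (le_antisymm h1 hpos)
    exact h.le_card_of_offPoints_eq_singleton hBP hcov hn ht hJ hJk hz

/-- A clique with only short lines and a point on many lines need many lines. -/
theorem IsLinear.card_le_of_clique_of_lineDeg (h : IsLinear L B) {V : Finset α} {T : ℝ} (hT0 : 0 ≤ T)
    (hT : ∀ l ∈ L, ((B l ∩ V).card : ℝ) ≤ T)
    (hV : ∀ p ∈ V, ∀ q ∈ V, p ≠ q → Joined L B p q) {q : α} (hq : q ∉ V) :
    (V.card : ℝ) + lineDeg L B q ≤ L.card + 2 * T + 1 := by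
  have h1 : (V.card : ℝ) ^ 2 - V.card ≤ ∑ l ∈ L, ((B l ∩ V).card : ℝ) ^ 2 := by
    have h2 : (V.offDiag.card : ℝ) ≤ ∑ l ∈ L, ((B l ∩ V).offDiag.card : ℝ) := by
      exact_mod_cast card_offDiag_le_of_clique hV
    rw [cast_offDiag_card] at h2
    refine h2.trans (Finset.sum_le_sum fun l _ => ?_)
    rw [cast_offDiag_card]
    exact sub_le_self _ (Nat.cast_nonneg _)
  -- Lines through `q` are disjoint on `V` and contribute at most T|V|; only the remaining lines
  -- enter the second moment bound.
  rw [← Finset.sum_filter_add_sum_filter_not L (fun l => q ∈ B l)] at h1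
  have h2 : ∑ l ∈ L.filter (fun l => q ∈ B l), ((B l ∩ V).card : ℝ) ^ 2 ≤ T * V.card := by
    have h3 : ∑ l ∈ L.filter (fun l => q ∈ B l), (B l ∩ V).card ≤ V.card := by
      rw [← Finset.card_biUnion]
      · exact Finset.card_le_card (Finset.biUnion_subset.2 fun l _ => Finset.inter_subset_right)
      · intro l hl l' hl' hne
        rw [Finset.mem_coe, Finset.mem_filter] at hl hl'
        refine Finset.disjoint_left.2 fun x hx hx' => ?_
        rw [Finset.mem_inter] at hx hx'
        rcases h l hl.1 l' hl'.1 x q hx.1 hl.2 hx'.1 hl'.2 with e | e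
        · exact hq (e ▸ hx.2)
        · exact hne e
    have h4 : ∑ l ∈ L.filter (fun l => q ∈ B l), ((B l ∩ V).card : ℝ) ≤ V.card := by
      exact_mod_cast h3
    refine le_trans ?_ (mul_le_mul_of_nonneg_left h4 hT0)
    rw [Finset.mul_sum]
    refine Finset.sum_le_sum fun l hl => ?_
    rw [sq]
    exact mul_le_mul_of_nonneg_right (hT l (Finset.mem_filter.1 hl).1) (Nat.cast_nonneg _)
  have h3 := (h.mono (Finset.filter_subset (fun l => q ∉ B l) L)).sum_sq_le V hT0
    (fun l hl => hT l (Finset.mem_filter.1 hl).1)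
  have h4 : (lineDeg L B q : ℝ) + (L.filter (fun l => q ∉ B l)).card = L.card := by
    exact_mod_cast Finset.card_filter_add_card_filter_not (s := L) (fun l => q ∈ B l)
  rcases (Nat.cast_nonneg V.card : (0 : ℝ) ≤ V.card).eq_or_lt with h0 | h0
  · have : (0 : ℝ) ≤ (L.filter (fun l => q ∉ B l)).card := Nat.cast_nonneg _
    linarith
  · have h5 : (V.card : ℝ) * (V.card - 1) ≤
        V.card * (T + ((L.filter (fun l => q ∉ B l)).card + T)) := by linarith
    have := le_of_mul_le_mul_left h5 h0
    linarith

/-- The case of `k - 1` long lines. -/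
theorem IsLinear.le_card_of_long_add_one_eq (h : IsLinear L B)
    {t : ℝ} (hn : (P.card : ℝ) = k * t + 1)
    (ht : ∀ l ∈ L, ((B l).card : ℝ) ≤ t) {J : Finset ι} (hJ : J ⊆ L) (hJk : J.card + 1 = k)
    {d e T : ℝ} (hT0 : 0 ≤ T) (hd : 0 ≤ d) (he : 0 ≤ e) (hT : ∀ l ∈ L \ J, ((B l).card : ℝ) ≤ T)
    (hdeg : ∀ p ∈ offPoints B P J, ∀ q ∈ offPoints B P J, p ≠ q → ¬ Joined L B p q →
      ∃ j ∈ J, ((B j).card : ℝ) ≤ lineDeg L B p + lineDeg L B q + e)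
    {V : Finset α} (hVR : V ⊆ offPoints B P J) (hVd : ((offPoints B P J).card : ℝ) ≤ V.card + d)
    (hV : ∀ p ∈ V, ∀ q ∈ V, p ≠ q → Joined L B p q)
    (hbig : 10 * (T + d + e + k + 1) ≤ t) : t + k ≤ L.card := by
  by_contra! hlt
  have htJ : ∀ l ∈ J, ((B l).card : ℝ) ≤ t := fun l hl => ht l (hJ hl)
  have hJk' : (J.card : ℝ) = k - 1 := by rw [← hJk]; push_cast; ring
  have hk0 : (0 : ℝ) ≤ k := Nat.cast_nonneg _
  have hP := card_le_card_offPoints_add (B := B) (P := P) J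
  rw [hn] at hP
  have hsum := sum_card_le htJ
  rw [hJk'] at hsum
  have hR : t + 1 ≤ (offPoints B P J).card := by linarith
  have hcardL : ((L \ J).card : ℝ) = L.card - (k - 1) := by
    rw [Finset.cast_card_sdiff hJ, hJk']
  have hclique : ∀ W ⊆ offPoints B P J, (∀ p ∈ W, ∀ q ∈ W, p ≠ q → Joined L B p q) →
      ∀ p ∈ W, ∀ q ∈ W, p ≠ q → Joined (L \ J) B p q := fun W hW hWc p hp q hq hpq =>
    (joined_sdiff_iff (mem_offPoints.1 (hW hp)).2).2 (hWc p hp q hq hpq)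
  -- Lines outside `J` have at most T points, so none contains the clique, and de Bruijn–Erdős
  -- applies to `L \ J`.
  have hdBE : ∀ W ⊆ offPoints B P J, (∀ p ∈ W, ∀ q ∈ W, p ≠ q → Joined L B p q) →
      T < W.card → 1 < (W.card : ℝ) → (W.card : ℝ) ≤ (L \ J).card := by
    intro W hW hWc hW1 hW2
    have := (h.mono (Finset.sdiff_subset (s := L) (t := J))).card_le_of_clique
      (hclique W hW hWc) (by exact_mod_cast hW2) (by
        intro l hl hWl
        have h1 : (W.card : ℝ) ≤ (B l).card := by exact_mod_cast Finset.card_le_card hWl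
        linarith [hT l hl])
    exact_mod_cast this
  by_cases hRc : ∀ p ∈ offPoints B P J, ∀ q ∈ offPoints B P J, p ≠ q → Joined L B p q
  · have := hdBE _ subset_rfl hRc (by linarith) (by linarith)
    linarith
  · push Not at hRc
    obtain ⟨p, hp, q, hq, hpq, hj⟩ := hRc
    obtain ⟨j, hjJ, hjd⟩ := hdeg p hp q hq hpq hj
    have h1 := hdBE V hVR hV (by linarith) (by linarith)
    have h2 := sum_card_le' htJ hjJ
    rw [hJk'] at h2
    -- A point of larger degree, together with the clique `V`, would force too many lines; `x` is
    -- erased because it may itself lie in `V`. The unjoined `p` and `q` have degree sum greater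
    -- than t - d - e, so one of them violates this bound.
    have hmain : ∀ x : α, (lineDeg L B x : ℝ) < (t - d - e) / 2 := by
      intro x
      by_contra! hx
      have h3 := h.card_le_of_clique_of_lineDeg (V := V.erase x) hT0 (by
        intro l hl
        by_cases hlJ : l ∈ J
        · have : B l ∩ V.erase x = ∅ := by
            refine Finset.disjoint_iff_inter_eq_empty.1 (Finset.disjoint_left.2 fun y hy hyV => ?_)
            exact (mem_offPoints.1 (hVR (Finset.mem_of_mem_erase hyV))).2 l hlJ hy
          rw [this]
          simpa using hT0
        · refine le_trans ?_ (hT l (Finset.mem_sdiff.2 ⟨hl, hlJ⟩))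
          exact_mod_cast Finset.card_le_card Finset.inter_subset_left)
        (fun y hy z hz => hV y (Finset.mem_of_mem_erase hy) z (Finset.mem_of_mem_erase hz))
        (Finset.notMem_erase x V)
      have h4 : (V.card : ℝ) ≤ (V.erase x).card + 1 := by
        have := Finset.pred_card_le_card_erase (s := V) (a := x)
        have h5 : V.card ≤ (V.erase x).card + 1 := by omega
        exact_mod_cast h5
      linarith
    linarith [hmain p, hmain q]

end LowerBound

/-! ### Assembling the lower bound. -/

section Main

open scoped Classical

variable {α ι : Type*} {L : Finset ι} {B : ι → Finset α} {P : Finset α} {k D : ℕ}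

theorem isIndep_singleton (p : α) : IsIndep L B {p} := by
  intro x hx y hy hxy
  rw [Finset.mem_singleton] at hx hy
  exact absurd (hx.trans hy.symm) hxy

theorem isIndep_pair {p q : α} (h : ¬ Joined L B p q) : IsIndep L B {p, q} :=
  (isIndep_singleton q).insert_point fun x hx hj => by
    rw [Finset.mem_singleton] at hx
    subst hx
    exact h hj.symm

/-- The lower bound with explicit scale `D`, of order the square root of the number of points. -/
theorem IsLinear.le_card_of_scale (h : IsLinear L B) (hBP : ∀ l ∈ L, B l ⊆ P) (hk : 1 ≤ k)
    (hcov : ∀ I ⊆ P, IsIndep L B I → I.card ≤ k) {t : ℝ} (hn : (P.card : ℝ) = k * t + 1)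
    (ht : ∀ l ∈ L, ((B l).card : ℝ) ≤ t) (hkleD : k ≤ D) (hD : P.card ≤ D * D)
    (hbig : 20000 * ((k : ℝ) ^ 3 * D) ≤ t) : t + k ≤ L.card := by
  by_contra! hlt
  have hD0 : 0 < D := hk.trans hkleD
  have hk1 : (1 : ℝ) ≤ k := by exact_mod_cast hk
  have hD1 : (1 : ℝ) ≤ D := by exact_mod_cast hD0
  have hkD : (k : ℝ) * D ≤ (k : ℝ) ^ 3 * D := by
    refine mul_le_mul_of_nonneg_right ?_ (by linarith)
    nlinarith [mul_nonneg (sub_nonneg.2 hk1) (sub_nonneg.2 hk1)]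
  have hk_kD : (k : ℝ) ≤ k * D := le_mul_of_one_le_right (by linarith) hD1
  have hD_kD : (D : ℝ) ≤ k * D := le_mul_of_one_le_left (by linarith) hk1
  have hkD' : k ≤ k * D := Nat.le_mul_of_pos_right _ hD0
  have hDkD' : D ≤ k * D := Nat.le_mul_of_pos_left _ hk
  have hLD : L.card ≤ D * D := by
    refine le_trans ?_ hD
    have h1 : (0 : ℝ) ≤ (k - 1) * (t - 1) := mul_nonneg (by linarith) (by linarith)
    have : (L.card : ℝ) ≤ P.card := by rw [hn]; linarith
    exact_mod_cast this
  -- The constant 8 leaves room for the losses below: at most 5kD for a transversal of k + 1 lines,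
  -- and at most 4kD + 3kD when low-degree points are extended.
  set J := L.filter (fun l => 8 * (k * D) ≤ (B l).card) with hJdef
  have hJ : J ⊆ L := Finset.filter_subset _ _
  have hJlong : ∀ {j}, j ∈ J → 8 * (k * D) ≤ (B j).card := fun hj => (Finset.mem_filter.1 hj).2
  have hshort : ∀ l ∈ L \ J, ((B l).card : ℝ) ≤ 8 * (k * D) := by
    intro l hl
    rw [Finset.mem_sdiff, hJdef, Finset.mem_filter, not_and, not_le] at hl
    exact_mod_cast (hl.2 hl.1).le
  have hJk : J.card ≤ k := by
    by_contra! hlt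
    obtain ⟨J', hJ', hJ'k⟩ := Finset.exists_subset_card_eq hlt
    obtain ⟨j, hj, hjle⟩ := h.exists_card_le_sum_lineDeg hBP hcov hLD hD0 (hJ'.trans hJ)
      (I := ∅) (by simp) (by intro p hp; simp at hp) (by simp) (by simp; omega)
    rw [hJ'k, Finset.sum_empty, Nat.mul_succ, mul_comm D k] at hjle
    have := hJlong (hJ' hj)
    have : k.succ ≤ 2 * (k * D) := by omega
    omega
  set R := offPoints B P J with hR
  have hkey : ∀ I ⊆ R, IsIndep L B I → k < I.card + J.card →
      ∃ j ∈ J, (B j).card ≤ ∑ q ∈ I, lineDeg L B q + 3 * (k * D) := by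
    intro I hI hIi hIk
    obtain ⟨j, hj, hjle⟩ := h.exists_card_le_sum_lineDeg hBP hcov hLD hD0 hJ
      (hI.trans offPoints_subset) hIi (fun x hx => (mem_offPoints.1 (hI hx)).2) hIk
    have h1 : D * J.card ≤ k * D := by rw [mul_comm]; exact Nat.mul_le_mul_right _ hJk
    exact ⟨j, hj, by omega⟩
  -- D points of degree at least 2D would need 2D² + D ≤ |L| + D² ≤ 2D².
  have hQ : (R.filter (fun q => 2 * D ≤ lineDeg L B q)).card ≤ D := by
    by_contra! hlt
    obtain ⟨Z, hZ, hZD⟩ := Finset.exists_subset_card_eq hlt.le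
    have h1 := h.card_mul_le (Z := Z) (d := 2 * D) fun q hq => (Finset.mem_filter.1 (hZ hq)).2
    rw [hZD, Nat.mul_left_comm] at h1
    omega
  set V := R.filter (fun q => ¬ 2 * D ≤ lineDeg L B q) with hV
  have hVR : V ⊆ R := Finset.filter_subset _ _
  have hRV : (R.card : ℝ) ≤ V.card + D := by
    have h1 : (R.filter (fun q => 2 * D ≤ lineDeg L B q)).card + V.card = R.card := by
      convert Finset.card_filter_add_card_filter_not (s := R) (fun q => 2 * D ≤ lineDeg L B q)
    have h2 : R.card ≤ V.card + D := by omega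
    exact_mod_cast h2
  -- A larger independent set, trimmed to k + 1 - |J| points, would by `hkey` bound some long line
  -- by (k + 1)·2D + 3kD < 8kD.
  have hVindep : ∀ I ⊆ V, IsIndep L B I → I.card + J.card ≤ k := by
    intro I hI hIi
    by_contra! hlt
    obtain ⟨I', hI', hI'k⟩ := Finset.exists_subset_card_eq (s := I) (n := k + 1 - J.card) (by omega)
    obtain ⟨j, hj, hjle⟩ := hkey I' ((hI'.trans hI).trans hVR) (hIi.mono hI') (by omega)
    have h1 : ∑ q ∈ I', lineDeg L B q ≤ I'.card * (2 * D) := by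
      refine Finset.sum_le_card_nsmul I' _ _ fun q hq => ?_
      exact (not_le.1 (Finset.mem_filter.1 (hI (hI' hq))).2).le
    have h2 : I'.card * (2 * D) ≤ (k + 1) * (2 * D) := Nat.mul_le_mul_right _ (by omega)
    have h3 : (k + 1) * (2 * D) = 2 * (k * D) + 2 * D := by ring
    have := hJlong hj
    omega
  rcases Nat.lt_or_ge k (J.card + 2) with hJ2 | hJ2
  · rcases Nat.lt_or_ge k (J.card + 1) with hJ1 | hJ1
    · have hJk' : J.card = k := by omega
      have hV0 : V.card = 0 := by
        rw [Finset.card_eq_zero, Finset.eq_empty_iff_forall_notMem]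
        intro q hq
        have := hVindep {q} (Finset.singleton_subset_iff.2 hq) (isIndep_singleton q)
        rw [Finset.card_singleton] at this
        omega
      rw [hV0, Nat.cast_zero, zero_add] at hRV
      have := h.le_card_of_long_eq hBP hcov hn ht hJ hJk' (d := D) (e := 3 * (k * D)) hRV (by
        intro q hq
        obtain ⟨j, hj, hjle⟩ := hkey {q} (Finset.singleton_subset_iff.2 hq) (isIndep_singleton q)
          (by rw [Finset.card_singleton]; omega)
        rw [Finset.sum_singleton] at hjle
        exact ⟨j, hj, by exact_mod_cast hjle⟩) (by linarith)
      linarith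
    · have hJk' : J.card + 1 = k := by omega
      have := h.le_card_of_long_add_one_eq hn ht hJ hJk' (d := D) (e := 3 * (k * D))
        (T := 8 * (k * D)) (by positivity) (by positivity) (by positivity) hshort (by
          intro p hp q hq hpq hj
          obtain ⟨j, hj, hjle⟩ := hkey {p, q} (by
            intro x hx
            rcases Finset.mem_insert.1 hx with rfl | hx
            · exact hp
            · rwa [Finset.mem_singleton.1 hx]) (isIndep_pair hj)
            (by rw [Finset.card_pair hpq]; omega)
          rw [Finset.sum_pair hpq] at hjle
          exact ⟨j, hj, by exact_mod_cast hjle⟩) hVR hRV (by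
          intro p hp q hq hpq
          by_contra hj
          have := hVindep {p, q} (by
            intro x hx
            rcases Finset.mem_insert.1 hx with rfl | hx
            · exact hp
            · rwa [Finset.mem_singleton.1 hx]) (isIndep_pair hj)
          rw [Finset.card_pair hpq] at this
          omega) (by linarith)
      linarith
  · obtain ⟨r, hr⟩ : ∃ r, k = J.card + r := ⟨k - J.card, by omega⟩
    have hr2 : 2 ≤ r := by omega
    have hr2' : (2 : ℝ) ≤ r := by exact_mod_cast hr2
    have hkr : (k : ℝ) = J.card + r := by exact_mod_cast hr
    have hrk : (r : ℝ) ≤ k := by rw [hkr]; linarith [(Nat.cast_nonneg J.card : (0 : ℝ) ≤ _)]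
    have ht0 : 0 ≤ t := le_trans (by positivity) hbig
    have hP := card_le_card_offPoints_add (B := B) (P := P) J
    have hsum := sum_card_le (J := J) (fun l hl => ht l (hJ hl))
    have hVlow : r * t + 1 - D ≤ (V.card : ℝ) := by
      rw [hn, hkr] at hP
      linarith
    have hrt : 2 * t ≤ r * t := mul_le_mul_of_nonneg_right hr2' ht0
    have hVt : t ≤ (V.card : ℝ) := by linarith
    have hk2 : (0 : ℝ) < 1200 * (k : ℝ) ^ 2 := by positivity
    have hε : ∀ c : ℝ, 1200 * (k : ℝ) ^ 2 * c ≤ t → c ≤ 1 / (1200 * (k : ℝ) ^ 2) * V.card := by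
      intro c hc
      rw [one_div, inv_mul_eq_div, le_div_iff₀ hk2]
      linarith
    -- This covers T = 8kD, and also the error in r|L| ≤ (1 + ε)|V|, which is at most D + rk ≤ 2kD.
    have h9 : 9 * ((k : ℝ) * D) ≤ 1 / (1200 * (k : ℝ) ^ 2) * V.card := by
      refine hε _ ?_
      have : (0 : ℝ) ≤ (k : ℝ) ^ 3 * D := by positivity
      linarith
    obtain ⟨I, hIV, hI, hIr⟩ := h.exists_indep_of_few_lines V hr2
      (ε := 1 / (1200 * (k : ℝ) ^ 2)) (T := 8 * (k * D)) (by
        rw [mul_one_div, div_le_one hk2]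
        have := pow_le_pow_left₀ (by linarith) hrk 2
        linarith) (by linarith) (by positivity) (by linarith) (by
        have h1 : r * (L.card : ℝ) ≤ r * (t + k) := mul_le_mul_of_nonneg_left hlt.le (by linarith)
        have h2 : (r : ℝ) * k ≤ k * D :=
          mul_le_mul hrk (by exact_mod_cast hkleD) (by linarith) (by linarith)
        linarith) (by
        intro l hl
        by_cases hlJ : l ∈ J
        · have : B l ∩ V = ∅ := by
            refine Finset.disjoint_iff_inter_eq_empty.1 (Finset.disjoint_left.2 fun y hy hyV => ?_)
            exact (mem_offPoints.1 (hVR hyV)).2 l hlJ hy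
          rw [this, Finset.card_empty, Nat.cast_zero]
          positivity
        · refine le_trans ?_ (hshort l (Finset.mem_sdiff.2 ⟨hl, hlJ⟩))
          exact_mod_cast Finset.card_le_card Finset.inter_subset_left)
    have := hVindep I hIV hI
    omega

/-- The lower bound for large linear systems. -/
theorem IsLinear.le_card (h : IsLinear L B) (hBP : ∀ l ∈ L, B l ⊆ P) (hk : 1 ≤ k)
    (hcov : ∀ I ⊆ P, IsIndep L B I → I.card ≤ k) {t : ℝ} (hn : (P.card : ℝ) = k * t + 1)
    (ht : ∀ l ∈ L, ((B l).card : ℝ) ≤ t) (hbig : (50000 * k ^ 4) ^ 2 ≤ P.card) :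
    t + k ≤ L.card := by
  have h1 : 50000 * k ^ 4 ≤ P.card.sqrt := Nat.le_sqrt'.2 hbig
  have h2 : P.card.sqrt ^ 2 ≤ P.card := Nat.sqrt_le' _
  have h3 : P.card < (P.card.sqrt + 1) ^ 2 := Nat.lt_succ_sqrt' _
  have hk4 : k ≤ k ^ 4 := Nat.le_self_pow (by norm_num) k
  -- Rounding the square root up ensures |P| ≤ D². The size hypothesis makes kt at least of order
  -- k⁴√|P|, hence t at least 20000k³D.
  refine h.le_card_of_scale hBP hk hcov hn ht (D := P.card.sqrt + 1) (by omega)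
    (by rw [← sq]; exact h3.le) ?_
  have h1' : 50000 * (k : ℝ) ^ 4 ≤ (P.card.sqrt : ℝ) := by exact_mod_cast h1
  have h2' : (P.card.sqrt : ℝ) ^ 2 ≤ P.card := by exact_mod_cast h2
  have hk1 : (1 : ℝ) ≤ k := by exact_mod_cast hk
  have hk4' : (1 : ℝ) ≤ (k : ℝ) ^ 4 := one_le_pow₀ hk1
  set S : ℝ := (P.card.sqrt : ℝ)
  have h4 : 50000 * (k : ℝ) ^ 4 * S ≤ S * S := mul_le_mul_of_nonneg_right h1' (by linarith)
  have h5 : (k : ℝ) ^ 4 * 1 ≤ (k : ℝ) ^ 4 * S :=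
    mul_le_mul_of_nonneg_left (by linarith) (by linarith)
  have h6 : (k : ℝ) * (20000 * ((k : ℝ) ^ 3 * (S + 1))) ≤ k * t := by
    have : (k : ℝ) * (20000 * ((k : ℝ) ^ 3 * (S + 1))) =
      20000 * ((k : ℝ) ^ 4 * S) + 20000 * (k : ℝ) ^ 4 := by ring
    rw [this]
    linarith
  push_cast
  exact le_of_mul_le_mul_left h6 (by linarith)

end Main

end LinearSystem

/-! ### Plane lines form a linear system. -/

/-- Two distinct lines of the plane share at most one point. -/
theorem IsPlaneLine.eq_of_mem {l l' : AffineSubspace ℝ Plane} (hl : IsPlaneLine l)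
    (hl' : IsPlaneLine l') {p q : Plane} (hpq : p ≠ q) (hp : p ∈ l) (hq : q ∈ l) (hp' : p ∈ l')
    (hq' : q ∈ l') : l = l' := by
  have hspan : ∀ m : AffineSubspace ℝ Plane, IsPlaneLine m → p ∈ m → q ∈ m →
      Submodule.span ℝ {q -ᵥ p} = m.direction := by
    intro m hm hpm hqm
    have hne : q -ᵥ p ≠ 0 := fun h => hpq (vsub_eq_zero_iff_eq.1 h).symm
    refine Submodule.eq_of_le_of_finrank_eq ?_ ?_
    · rw [Submodule.span_singleton_le_iff_mem]
      exact AffineSubspace.vsub_mem_direction hqm hpm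
    · rw [finrank_span_singleton hne, hm]
  exact AffineSubspace.ext_of_direction_eq ((hspan l hl hp hq).symm.trans (hspan l' hl' hp' hq'))
    ⟨p, hp, hp'⟩

open scoped Classical in
theorem IsPlaneCover.le_card {s : ℕ} (hs : 2 ≤ s) {P : Finset Plane}
    {L : Finset (AffineSubspace ℝ Plane)} (h : IsPlaneCover s P L)
    (hbig : (50000 * (s - 1) ^ 4) ^ 2 ≤ P.card) :
    ((P.card : ℝ) - 1) / ((s : ℝ) - 1) + (s : ℝ) - 1 ≤ (L.card : ℝ) := by
  obtain ⟨k, rfl⟩ : ∃ k, s = k + 1 := ⟨s - 1, by omega⟩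
  have hk : (k : ℝ) ≠ 0 := by exact_mod_cast (show k ≠ 0 by omega)
  have e : ((k + 1 : ℕ) : ℝ) - 1 = k := by push_cast; ring
  have hcl := h.card_le
  rw [e] at hcl
  set B : AffineSubspace ℝ Plane → Finset Plane := fun l => P.filter (fun p => p ∈ l) with hB
  have hBmem : ∀ {l p}, p ∈ B l ↔ p ∈ P ∧ p ∈ l := Finset.mem_filter
  have hlin : LinearSystem.IsLinear L B := by
    intro l hl l' hl' p q h1 h2 h3 h4
    by_cases hpq : p = q
    · exact Or.inl hpq
    · exact Or.inr ((h.isLine l hl).eq_of_mem (h.isLine l' hl') hpq (hBmem.1 h1).2 (hBmem.1 h2).2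
        (hBmem.1 h3).2 (hBmem.1 h4).2)
  have := hlin.le_card (P := P) (k := k) (t := ((P.card : ℝ) - 1) / k)
    (fun l _ => Finset.filter_subset _ _) (by omega) (by
      intro I hI hIi
      by_contra! hlt
      obtain ⟨S, hS, hSc⟩ := Finset.exists_subset_card_eq hlt
      obtain ⟨l, hl, p, hp, q, hq, hpq, hpl, hql⟩ := h.covers S (hS.trans hI) hSc
      exact hIi p (hS hp) q (hS hq) hpq
        ⟨l, hl, hBmem.2 ⟨hI (hS hp), hpl⟩, hBmem.2 ⟨hI (hS hq), hql⟩⟩)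
    (by field_simp; ring) (by
      intro l hl
      have h1 : {p : Plane | p ∈ P ∧ p ∈ l} = (B l : Set Plane) := by
        ext p
        simp [hB]
      have h2 := hcl l hl
      rwa [h1, Set.ncard_coe_finset] at h2) (by simpa using hbig)
  rw [add_sub_assoc, e]
  exact this

/-! ### Planar realization of the grid. -/

/-- The vertical line of the plane through `(c, 0)`. -/
noncomputable def verticalLine (c : ℝ) : AffineSubspace ℝ Plane :=
  AffineSubspace.mk' !₂[c, 0] (Submodule.span ℝ {!₂[0, 1]})

/-- The line of the plane through the origin with slope `a`. -/
noncomputable def slopeLine (a : ℝ) : AffineSubspace ℝ Plane :=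
  AffineSubspace.mk' 0 (Submodule.span ℝ {!₂[1, a]})

theorem mem_verticalLine {c : ℝ} {p : Plane} : p ∈ verticalLine c ↔ p 0 = c := by
  rw [verticalLine, AffineSubspace.mem_mk', Submodule.mem_span_singleton]
  constructor
  · rintro ⟨a, ha⟩
    have := congrArg (fun v : Plane => v 0) ha
    simp at this
    linarith
  · intro h
    refine ⟨p 1, ?_⟩
    ext i
    fin_cases i <;> simp [h]

theorem mem_slopeLine {a : ℝ} {p : Plane} : p ∈ slopeLine a ↔ p 1 = a * p 0 := by
  rw [slopeLine, AffineSubspace.mem_mk', Submodule.mem_span_singleton]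
  constructor
  · rintro ⟨b, hb⟩
    have h0 := congrArg (fun v : Plane => v 0) hb
    have h1 := congrArg (fun v : Plane => v 1) hb
    simp at h0 h1
    rw [← h0, ← h1, mul_comm]
  · intro h
    refine ⟨p 0, ?_⟩
    ext i
    fin_cases i <;> simp [h, mul_comm]

theorem isPlaneLine_verticalLine (c : ℝ) : IsPlaneLine (verticalLine c) := by
  rw [IsPlaneLine, verticalLine, AffineSubspace.direction_mk']
  refine finrank_span_singleton fun h => ?_
  simpa using congrArg (fun v : Plane => v 1) h

theorem isPlaneLine_slopeLine (a : ℝ) : IsPlaneLine (slopeLine a) := by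
  rw [IsPlaneLine, slopeLine, AffineSubspace.direction_mk']
  refine finrank_span_singleton fun h => ?_
  simpa using congrArg (fun v : Plane => v 0) h

/-- The points of a planar realization of the grid with one extra point. -/
noncomputable def gridPoint (t k : ℕ) : Option (Fin t × Fin k) → Plane
  | none => 0
  -- The shift by 1 keeps the columns off the origin, where all the rows meet.
  | some (j, i) => !₂[(i : ℝ) + 1, j * ((i : ℝ) + 1)]

/-- The lines of a planar realization of the grid with one extra point. -/
noncomputable def gridPlaneLine (t k : ℕ) : Fin k ⊕ Fin t → AffineSubspace ℝ Plane
  | Sum.inl i => verticalLine ((i : ℝ) + 1)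
  | Sum.inr j => slopeLine j

theorem isPlaneLine_gridPlaneLine (t k : ℕ) (c : Fin k ⊕ Fin t) :
    IsPlaneLine (gridPlaneLine t k c) := by
  rcases c with i | j
  · exact isPlaneLine_verticalLine _
  · exact isPlaneLine_slopeLine _

theorem gridPoint_mem_gridPlaneLine {t k : ℕ} (x : Option (Fin t × Fin k)) (c : Fin k ⊕ Fin t) :
    gridPoint t k x ∈ gridPlaneLine t k c ↔ x ∈ gridLine t k c := by
  rcases x with _ | ⟨j, i⟩ <;> rcases c with i' | j'
  · have : (0 : ℝ) ≠ (i' : ℝ) + 1 := by positivity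
    simpa [gridPoint, gridPlaneLine, gridLine, mem_verticalLine] using this
  · simp [gridPoint, gridPlaneLine, gridLine, mem_slopeLine]
  · simp [gridPoint, gridPlaneLine, gridLine, mem_verticalLine, Fin.ext_iff]
  · have : (i : ℝ) + 1 ≠ 0 := by positivity
    simp [gridPoint, gridPlaneLine, gridLine, mem_slopeLine, this, Fin.ext_iff]

/-- Incidences separate the points: z is on no column, and any other point is determined by its
column and row. -/
theorem gridPoint_injective (t k : ℕ) : Function.Injective (gridPoint t k) := by
  intro x y hxy
  have hmem : ∀ c, x ∈ gridLine t k c ↔ y ∈ gridLine t k c := fun c => by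
    rw [← gridPoint_mem_gridPlaneLine, hxy, gridPoint_mem_gridPlaneLine]
  rcases x with _ | ⟨j, i⟩ <;> rcases y with _ | ⟨j', i'⟩
  · rfl
  · simpa [gridLine] using hmem (Sum.inl i')
  · simpa [gridLine] using hmem (Sum.inl i)
  · have h1 := hmem (Sum.inl i)
    have h2 := hmem (Sum.inr j)
    simp [gridLine] at h1 h2
    rw [h1, h2]

theorem gridPlaneLine_injective {t k : ℕ} (hk : 0 < k) (ht : 0 < t) :
    Function.Injective (gridPlaneLine t k) := by
  intro c d hcd
  have hmem : ∀ x, x ∈ gridLine t k c ↔ x ∈ gridLine t k d := fun x => by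
    rw [← gridPoint_mem_gridPlaneLine, hcd, gridPoint_mem_gridPlaneLine]
  rcases c with i | j <;> rcases d with i' | j'
  · have := hmem (some (⟨0, ht⟩, i))
    simp [gridLine] at this
    rw [this]
  · simpa [gridLine] using hmem none
  · simpa [gridLine] using hmem none
  · have := hmem (some (j, ⟨0, hk⟩))
    simp [gridLine] at this
    rw [this]

/-- A column has t points but an extended row has k + 1, hence the assumption on t. -/
theorem ncard_gridLine_le {t k : ℕ} (hkt : k + 1 ≤ t) (c : Fin k ⊕ Fin t) :
    (gridLine t k c).ncard ≤ t := by
  rcases c with i | j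
  · have : gridLine t k (Sum.inl i) = Set.range (fun j : Fin t => some (j, i)) := by
      ext x
      simp [gridLine, eq_comm]
    rw [this, ← Set.image_univ]
    refine (Set.ncard_image_le).trans ?_
    simp
  · have : gridLine t k (Sum.inr j) = insert none (Set.range (fun i : Fin k => some (j, i))) := by
      ext x
      simp [gridLine, eq_comm]
    rw [this, ← Set.image_univ]
    refine (Set.ncard_insert_le _ _).trans (le_trans (Nat.add_le_add_right ?_ 1) hkt)
    refine (Set.ncard_image_le).trans ?_
    simp

/-- If z is in the set, a row joins it to any other point; otherwise k + 1 points in k columns put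
two in the same column. -/
theorem exists_gridLine_of_card {t k : ℕ} (hk : 0 < k) {S : Finset (Option (Fin t × Fin k))}
    (hS : S.card = k + 1) : ∃ c, ∃ x ∈ S, ∃ y ∈ S, x ≠ y ∧ x ∈ gridLine t k c ∧
      y ∈ gridLine t k c := by
  by_cases hz : none ∈ S
  · obtain ⟨x, hx, hxz⟩ := Finset.exists_mem_ne (show 1 < S.card by omega) none
    obtain ⟨⟨j, i⟩, rfl⟩ := Option.ne_none_iff_exists'.1 hxz
    exact ⟨Sum.inr j, _, hx, _, hz, hxz, by simp [gridLine], by simp [gridLine]⟩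
  · have hsome : ∀ x ∈ S, ∃ j i, x = some (j, i) := by
      intro x hx
      obtain ⟨⟨j, i⟩, rfl⟩ := Option.ne_none_iff_exists'.1 (fun e : x = none => hz (e ▸ hx))
      exact ⟨j, i, rfl⟩
    obtain ⟨x, hx, y, hy, hxy, he⟩ := Finset.exists_ne_map_eq_of_card_lt_of_maps_to
      (s := S) (t := (Finset.univ : Finset (Option (Fin k))).erase none)
      (f := fun x => x.map Prod.snd) (by simp [hS]) (by
        intro x hx
        obtain ⟨j, i, rfl⟩ := hsome x hx
        simp)
    obtain ⟨j, i, rfl⟩ := hsome x hx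
    obtain ⟨j', i', rfl⟩ := hsome y hy
    simp at he
    exact ⟨Sum.inl i, _, hx, _, hy, hxy, by simp [gridLine], by simp [gridLine, he]⟩

open scoped Classical in
/-- The grid with one extra point has a planar realization, which is extremal. -/
theorem exists_isGridRealization {t k : ℕ} (hk : 0 < k) (hkt : k + 1 ≤ t) :
    ∃ (P : Finset Plane) (L : Finset (AffineSubspace ℝ Plane)),
      P.card = k * t + 1 ∧ IsPlaneCover (k + 1) P L ∧ L.card = k + t ∧ IsGridRealization t k P L := by
  have hk' : (k : ℝ) ≠ 0 := by exact_mod_cast hk.ne'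
  set P : Finset Plane := Finset.univ.image (gridPoint t k) with hP
  set L : Finset (AffineSubspace ℝ Plane) := Finset.univ.image (gridPlaneLine t k) with hL
  have hpi := gridPoint_injective t k
  have hli := gridPlaneLine_injective (t := t) (k := k) hk (by omega)
  have hPc : P.card = k * t + 1 := by
    rw [hP, Finset.card_image_of_injective _ hpi]
    simp [mul_comm]
  refine ⟨P, L, hPc, ⟨?_, ?_, ?_⟩, ?_, ?_⟩
  · intro l hl
    obtain ⟨c, -, rfl⟩ := Finset.mem_image.1 hl
    exact isPlaneLine_gridPlaneLine t k c
  · intro l hl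
    obtain ⟨c, -, rfl⟩ := Finset.mem_image.1 hl
    have h1 : {p : Plane | p ∈ P ∧ p ∈ gridPlaneLine t k c} = gridPoint t k '' gridLine t k c := by
      ext p
      constructor
      · rintro ⟨hp, hpc⟩
        obtain ⟨x, -, rfl⟩ := Finset.mem_image.1 hp
        exact ⟨x, (gridPoint_mem_gridPlaneLine x c).1 hpc, rfl⟩
      · rintro ⟨x, hx, rfl⟩
        exact ⟨Finset.mem_image_of_mem _ (Finset.mem_univ _),
          (gridPoint_mem_gridPlaneLine x c).2 hx⟩
    rw [h1, Set.ncard_image_of_injective _ hpi, hPc]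
    have h2 : ((gridLine t k c).ncard : ℝ) ≤ t := by exact_mod_cast ncard_gridLine_le hkt c
    refine h2.trans (le_of_eq ?_)
    push_cast
    rw [add_sub_cancel_right, add_sub_cancel_right, mul_div_cancel_left₀ _ hk']
  · intro S hSP hS
    obtain ⟨c, x, hx, y, hy, hxy, hxc, hyc⟩ := exists_gridLine_of_card hk
      (S := Finset.univ.filter (fun x => gridPoint t k x ∈ S)) (by
        rw [← hS, ← Finset.card_image_of_injective _ hpi]
        congr 1
        ext p
        simp only [Finset.mem_image, Finset.mem_filter, Finset.mem_univ, true_and]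
        constructor
        · rintro ⟨x, hx, rfl⟩
          exact hx
        · intro hp
          obtain ⟨x, -, rfl⟩ := Finset.mem_image.1 (hSP hp)
          exact ⟨x, hp, rfl⟩)
    exact ⟨_, Finset.mem_image_of_mem _ (Finset.mem_univ c), _, (Finset.mem_filter.1 hx).2, _,
      (Finset.mem_filter.1 hy).2, hpi.ne hxy, (gridPoint_mem_gridPlaneLine x c).2 hxc,
      (gridPoint_mem_gridPlaneLine y c).2 hyc⟩
  · rw [hL, Finset.card_image_of_injective _ hli]
    simp
  · have hPmem : ∀ x, gridPoint t k x ∈ P := fun x => Finset.mem_image_of_mem _ (Finset.mem_univ x)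
    have hLmem : ∀ c, gridPlaneLine t k c ∈ L := fun c =>
      Finset.mem_image_of_mem _ (Finset.mem_univ c)
    refine ⟨Equiv.ofBijective (fun x => ⟨gridPoint t k x, hPmem x⟩) ⟨?_, ?_⟩,
      Equiv.ofBijective (fun c => ⟨gridPlaneLine t k c, hLmem c⟩) ⟨?_, ?_⟩,
      gridPoint_mem_gridPlaneLine⟩
    · exact fun x y hxy => hpi (congrArg Subtype.val hxy)
    · rintro ⟨p, hp⟩
      obtain ⟨x, -, rfl⟩ := Finset.mem_image.1 hp
      exact ⟨x, rfl⟩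
    · exact fun x y hxy => hli (congrArg Subtype.val hxy)
    · rintro ⟨l, hl⟩
      obtain ⟨c, -, rfl⟩ := Finset.mem_image.1 hl
      exact ⟨c, rfl⟩

theorem mainTheorem3 (s : ℕ) (hs : 2 ≤ s) :
    ∃ n₀ : ℕ, ∀ n : ℕ, n₀ ≤ n →
      (∀ (P : Finset Plane) (L : Finset (AffineSubspace ℝ Plane)),
        P.card = n → IsPlaneCover s P L →
          ((n : ℝ) - 1) / ((s : ℝ) - 1) + (s : ℝ) - 1 ≤ (L.card : ℝ)) ∧
      ((s - 1) ∣ (n - 1) →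
        ∃ (P : Finset Plane) (L : Finset (AffineSubspace ℝ Plane)),
          P.card = n ∧ IsPlaneCover s P L ∧
          (L.card : ℝ) = ((n : ℝ) - 1) / ((s : ℝ) - 1) + (s : ℝ) - 1 ∧
          IsGridRealization ((n - 1) / (s - 1)) (s - 1) P L) := by
  -- The square serves the lower bound; the term s² ensures t ≥ s, so that the extended rows of the
  -- grid are not too long.
  refine ⟨(50000 * (s - 1) ^ 4) ^ 2 + s * s + 1, fun n hn => ⟨?_, ?_⟩⟩
  · rintro P L rfl h
    exact h.le_card hs (by omega)
  · rintro ⟨t, ht⟩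
    obtain ⟨k, rfl⟩ : ∃ k, s = k + 1 := ⟨s - 1, by omega⟩
    rw [Nat.add_sub_cancel] at ht ⊢
    have hk : 0 < k := by omega
    have hn' : n = k * t + 1 := by omega
    have hkt : k + 1 ≤ t := by
      have h1 : (k + 1) * (k + 1) ≤ k * t := by omega
      by_contra! hlt
      have h2 : k * t ≤ k * (k + 1) := Nat.mul_le_mul_left k hlt.le
      nlinarith
    obtain ⟨P, L, hP, hcov, hL, hgrid⟩ := exists_isGridRealization hk hkt
    refine ⟨P, L, hP.trans hn'.symm, hcov, ?_, ?_⟩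
    · have hk' : (k : ℝ) ≠ 0 := by exact_mod_cast hk.ne'
      rw [hL, hn']
      push_cast
      rw [add_sub_cancel_right, add_sub_cancel_right, mul_div_cancel_left₀ _ hk']
      ring
    · rwa [ht, Nat.mul_div_cancel_left t hk]
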